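/- Let $G$ be a compact Lie group with Lie algebra $\mathfrak g=T_eG$ and a bi-invariant Riemannian metric $g_0$, and write $\langle\cdot,\cdot\rangle_0$ for the scalar product that $g_0$ induces on $\mathfrak g$. Let $H\subset G$ be a torus with Lie algebra $\mathfrak h\subset\mathfrak g$, and let $\mathfrak u$ be the $g_0$-orthogonal complement in $\mathfrak g$ of the centralizer of $\mathfrak h$ in $\mathfrak g$. Let $\lambda,\lambda':\mathfrak g\to\mathfrak g$ be linear maps with image contained in $\mathfrak h$ and with $\lambda|_{\mathfrak h\oplus\mathfrak u}=\lambda'|_{\mathfrak h\oplus\mathfrak u}=0$. Assume that for every $Z\in\mathfrak h$ there is $a_Z\in G$ such that $\mathrm{Ad}_{a_Z}|_{\mathfrak h}=\mathrm{Id}$ and $$\langle\lambda'(X),Z\rangle_0=\langle\lambda(\mathrm{Ad}_{a_Z}X),Z\rangle_0\quad\text{for all }X\in\mathfrak g.$$ Let $g_\lambda$ be the left invariant metric on $G$ corresponding to the scalar product $\langle X,Y\rangle_\lambda:=\langle X+\lambda(X),Y+\lambda(Y)\rangle_0$ on $\mathfrak g$, let $\mathrm{Ric}^\lambda$ be its Ricci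 tensor, regarded as a bilinear form on $\mathfrak g$, and let $\|\mathrm{Ric}^\lambda\|_\lambda$ be its norm with respect to $\langle\cdot,\cdot\rangle_\lambda$; define $g_{\lambda'}$, $\mathrm{Ric}^{\lambda'}$ and $\|\mathrm{Ric}^{\lambda'}\|_{\lambda'}$ likewise. Let $j,j':\mathfrak g\to\mathfrak g$ be the transposes of $\lambda,\lambda'$ with respect to $\langle\cdot,\cdot\rangle_0$, write $j_Z:=j(Z)$, $j'_Z:=j'(Z)$, and let $\{Z_1,\dots,Z_r\}$ be a $g_0$-orthonormal basis of $\mathfrak h$. Then $$\|\mathrm{Ric}^\lambda\|_\lambda^2-\|\mathrm{Ric}^{\lambda'}\|_{\lambda'}^2=\frac14\Bigl(\sum_{i,k=1}^r\mathrm{tr}\bigl((\mathrm{ad}_{j_{Z_i}})^2(\mathrm{ad}_{j_{Z_k}})^2\bigr)-\sum_{i,k=1}^r\mathrm{tr}\bigl((\mathrm{ad}_{j'_{Z_i}})^2(\mathrm{ad}_{j'_{Z_k}})^2\bigr)\Bigr).$$ -/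

import Mathlib

open scoped Manifold ContDiff
open Bundle VectorField

namespace LeftInvariantRicci

noncomputable section

/-- A smooth real Lie group has the regularity that Mathlib asks for in order to equip its tangent
space at the identity with the Lie bracket of left invariant vector fields. -/
instance instLieGroupMinSmoothness {E : Type*} [NormedAddCommGroup E] [NormedSpace ℝ E]
    {G : Type*} [TopologicalSpace G] [ChartedSpace E G] [Group G] [LieGroup 𝓘(ℝ, E) ∞ G] :
    LieGroup 𝓘(ℝ, E) (minSmoothness ℝ 3) G :=
  LieGroup.of_le (m := minSmoothness ℝ 3) (n := ∞) (by simpa using! ENat.LEInfty.out)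

/-! ### Linear algebra -/

/-- The centralizer of a subspace of a Lie algebra. -/
def centralizer {L : Type*} [LieRing L] [LieAlgebra ℝ L] (h : Submodule ℝ L) : Submodule ℝ L where
  carrier := {X | ∀ Z ∈ h, ⁅X, Z⁆ = 0}
  add_mem' := fun hX hY Z hZ ↦ by rw [add_lie, hX Z hZ, hY Z hZ, add_zero]
  zero_mem' := fun Z _ ↦ zero_lie Z
  smul_mem' := fun c X hX Z hZ ↦ by rw [smul_lie, hX Z hZ, smul_zero]

/-- The square of the norm, with respect to a scalar product `B`, of a covariant `2`-tensor `b`: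
`B^{ik} B^{jl} b_{ij} b_{kl}` in the components with respect to a basis. -/
def tensorNormSq {V : Type*} [AddCommGroup V] [Module ℝ V] [FiniteDimensional ℝ V]
    (B : LinearMap.BilinForm ℝ V) (b : V → V → ℝ) : ℝ :=
  let e := Module.finBasis ℝ V
  let Q : Matrix _ _ ℝ := (Matrix.of fun i j ↦ B (e i) (e j))⁻¹
  ∑ i, ∑ j, ∑ k, ∑ l, Q i k * Q j l * b (e i) (e j) * b (e k) (e l)

/-! ### Levi-Civita connection and curvature of a metric on a manifold -/

section Manifold

variable {E : Type*} [NormedAddCommGroup E] [NormedSpace ℝ E]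
  {M : Type*} [TopologicalSpace M] [ChartedSpace E M] [IsManifold 𝓘(ℝ, E) ∞ M]

/-- The right-hand side of Koszul's formula,
`½ (X⟨Y,W⟩ + Y⟨X,W⟩ - W⟨X,Y⟩ + ⟨[X,Y],W⟩ - ⟨[X,W],Y⟩ - ⟨[Y,W],X⟩)` at `x`. -/
def koszul (g : ∀ x : M, LinearMap.BilinForm ℝ (TangentSpace 𝓘(ℝ, E) x))
    (X Y W : ∀ x : M, TangentSpace 𝓘(ℝ, E) x) (x : M) : ℝ :=
  (1 / 2) *
    (mvfderiv 𝓘(ℝ, E) (fun y ↦ g y (Y y) (W y)) x (X x)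
      + mvfderiv 𝓘(ℝ, E) (fun y ↦ g y (X y) (W y)) x (Y x)
      - mvfderiv 𝓘(ℝ, E) (fun y ↦ g y (X y) (Y y)) x (W x)
      + g x (mlieBracket 𝓘(ℝ, E) X Y x) (W x)
      - g x (mlieBracket 𝓘(ℝ, E) X W x) (Y x)
      - g x (mlieBracket 𝓘(ℝ, E) Y W x) (X x))

/-- The covariant derivative `∇_X Y` of the Levi-Civita connection of `g`: its value at `x` is the
vector `v` with `⟨v, W⟩ = koszul X Y W` at `x` for all vector fields `W` differentiable at `x`. -/
def leviCivita (g : ∀ x : M, LinearMap.BilinForm ℝ (TangentSpace 𝓘(ℝ, E) x))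
    (X Y : ∀ x : M, TangentSpace 𝓘(ℝ, E) x) (x : M) : TangentSpace 𝓘(ℝ, E) x :=
  Classical.epsilon fun v : TangentSpace 𝓘(ℝ, E) x ↦
    ∀ W : ∀ x : M, TangentSpace 𝓘(ℝ, E) x,
      MDifferentiableAt 𝓘(ℝ, E) (𝓘(ℝ, E).prod 𝓘(ℝ, E))
        (fun y ↦ (W y : TangentBundle 𝓘(ℝ, E) M)) x →
      g x v (W x) = koszul g X Y W x

/-- `R(X,Y)Z = ∇_X ∇_Y Z - ∇_Y ∇_X Z - ∇_[X,Y] Z`. -/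
def curvature (g : ∀ x : M, LinearMap.BilinForm ℝ (TangentSpace 𝓘(ℝ, E) x))
    (X Y Z : ∀ x : M, TangentSpace 𝓘(ℝ, E) x) (x : M) : TangentSpace 𝓘(ℝ, E) x :=
  leviCivita g X (leviCivita g Y Z) x - leviCivita g Y (leviCivita g X Z) x
    - leviCivita g (mlieBracket 𝓘(ℝ, E) X Y) Z x

end Manifold

/-! ### Lie groups with left invariant metrics -/

section Group

variable {E : Type*} [NormedAddCommGroup E] [NormedSpace ℝ E]
  {G : Type*} [TopologicalSpace G] [ChartedSpace E G] [Group G]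

/-- The adjoint representation: `Ad a` is the differential at the identity of `x ↦ a x a⁻¹`. -/
def Ad (a : G) : GroupLieAlgebra 𝓘(ℝ, E) G →ₗ[ℝ] GroupLieAlgebra 𝓘(ℝ, E) G where
  toFun v := mfderiv 𝓘(ℝ, E) 𝓘(ℝ, E) (fun x : G ↦ a * x * a⁻¹) 1 v
  map_add' v w := map_add (mfderiv 𝓘(ℝ, E) 𝓘(ℝ, E) (fun x : G ↦ a * x * a⁻¹) 1) v w
  map_smul' c v := map_smul (mfderiv 𝓘(ℝ, E) 𝓘(ℝ, E) (fun x : G ↦ a * x * a⁻¹) 1) c v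

/-- The differential at `x` of the left translation by `x⁻¹`, from `T_x G` to the Lie algebra. -/
def toLieAlgebra (x : G) : TangentSpace 𝓘(ℝ, E) x →ₗ[ℝ] GroupLieAlgebra 𝓘(ℝ, E) G where
  toFun v := mfderiv 𝓘(ℝ, E) 𝓘(ℝ, E) (fun y : G ↦ x⁻¹ * y) x v
  map_add' v w := map_add (mfderiv 𝓘(ℝ, E) 𝓘(ℝ, E) (fun y : G ↦ x⁻¹ * y) x) v w
  map_smul' c v := map_smul (mfderiv 𝓘(ℝ, E) 𝓘(ℝ, E) (fun y : G ↦ x⁻¹ * y) x) c v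

/-- The left invariant metric on `G` corresponding to the scalar product `B` on the Lie algebra. -/
def leftInvariantMetric (B : LinearMap.BilinForm ℝ (GroupLieAlgebra 𝓘(ℝ, E) G)) (x : G) :
    LinearMap.BilinForm ℝ (TangentSpace 𝓘(ℝ, E) x) :=
  B.compl₁₂ (toLieAlgebra x) (toLieAlgebra x)

/-- A Riemannian metric is bi-invariant if all left and right translations are isometries. -/
def IsBiInvariant [IsManifold 𝓘(ℝ, E) ∞ G]
    (g : ContMDiffRiemannianMetric 𝓘(ℝ, E) ∞ E (fun x : G ↦ TangentSpace 𝓘(ℝ, E) x)) : Prop :=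
  (∀ (a x : G) (v w : TangentSpace 𝓘(ℝ, E) x),
    g.inner (a * x) (mfderiv 𝓘(ℝ, E) 𝓘(ℝ, E) (fun y : G ↦ a * y) x v)
      (mfderiv 𝓘(ℝ, E) 𝓘(ℝ, E) (fun y : G ↦ a * y) x w) = g.inner x v w) ∧
  (∀ (a x : G) (v w : TangentSpace 𝓘(ℝ, E) x),
    g.inner (x * a) (mfderiv 𝓘(ℝ, E) 𝓘(ℝ, E) (fun y : G ↦ y * a) x v)
      (mfderiv 𝓘(ℝ, E) 𝓘(ℝ, E) (fun y : G ↦ y * a) x w) = g.inner x v w)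

/-- The scalar product on the Lie algebra given by a Riemannian metric. -/
def scalarProduct [IsManifold 𝓘(ℝ, E) ∞ G]
    (g : ContMDiffRiemannianMetric 𝓘(ℝ, E) ∞ E (fun x : G ↦ TangentSpace 𝓘(ℝ, E) x)) :
    LinearMap.BilinForm ℝ (GroupLieAlgebra 𝓘(ℝ, E) G) :=
  LinearMap.mk₂ ℝ (fun v w ↦ g.inner 1 v w) (by simp) (by simp) (by simp) (by simp)

theorem scalarProduct_nondegenerate [IsManifold 𝓘(ℝ, E) ∞ G]
    (g : ContMDiffRiemannianMetric 𝓘(ℝ, E) ∞ E (fun x : G ↦ TangentSpace 𝓘(ℝ, E) x)) :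
    (scalarProduct g).Nondegenerate := by
  refine (LinearMap.IsSymm.isRefl ⟨fun v w ↦ g.symm 1 v w⟩).nondegenerate_iff_separatingLeft.mpr ?_
  intro v hv
  by_contra h
  exact (g.pos 1 v h).ne' (hv v)

/-- The differential at the identity of a homomorphism of Lie groups. -/
def differential {F : Type*} [NormedAddCommGroup F] [NormedSpace ℝ F]
    {H : Type*} [TopologicalSpace H] [ChartedSpace F H] [Group H] (i : H →* G) :
    GroupLieAlgebra 𝓘(ℝ, F) H →ₗ[ℝ] GroupLieAlgebra 𝓘(ℝ, E) G where
  toFun v := mfderiv 𝓘(ℝ, F) 𝓘(ℝ, E) (fun x : H ↦ i x) 1 v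
  map_add' v w := map_add (mfderiv 𝓘(ℝ, F) 𝓘(ℝ, E) (fun x : H ↦ i x) 1) v w
  map_smul' c v := map_smul (mfderiv 𝓘(ℝ, F) 𝓘(ℝ, E) (fun x : H ↦ i x) 1) c v

variable [FiniteDimensional ℝ E]

/-- The Lie algebra of `G` is the model space `E` as a vector space. -/
instance instFiniteDimensionalGroupLieAlgebra :
    FiniteDimensional ℝ (GroupLieAlgebra 𝓘(ℝ, E) G) :=
  inferInstanceAs (FiniteDimensional ℝ E)

/-- The Ricci tensor at the identity of a metric `g` on a Lie group: `Ric(v,w)` is the trace of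
`u ↦ R(u,v)w`. By tensoriality of the curvature, the vectors may be extended to any smooth vector
fields; the left invariant ones are used. -/
def ricci [LieGroup 𝓘(ℝ, E) ∞ G] (g : ∀ x : G, LinearMap.BilinForm ℝ (TangentSpace 𝓘(ℝ, E) x))
    (v w : GroupLieAlgebra 𝓘(ℝ, E) G) : ℝ :=
  ∑ i, (Module.finBasis ℝ (GroupLieAlgebra 𝓘(ℝ, E) G)).coord i
    (curvature g
      (mulInvariantVectorField (Module.finBasis ℝ (GroupLieAlgebra 𝓘(ℝ, E) G) i))
      (mulInvariantVectorField v) (mulInvariantVectorField w) 1)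

/-- The transpose of an endomorphism of the Lie algebra with respect to the scalar product:
`⟨transpose φ X, Y⟩ = ⟨X, φ Y⟩`. -/
def transpose [IsManifold 𝓘(ℝ, E) ∞ G]
    (g : ContMDiffRiemannianMetric 𝓘(ℝ, E) ∞ E (fun x : G ↦ TangentSpace 𝓘(ℝ, E) x))
    (φ : GroupLieAlgebra 𝓘(ℝ, E) G →ₗ[ℝ] GroupLieAlgebra 𝓘(ℝ, E) G) :
    GroupLieAlgebra 𝓘(ℝ, E) G →ₗ[ℝ] GroupLieAlgebra 𝓘(ℝ, E) G :=
  LinearMap.BilinForm.leftAdjointOfNondegenerate (scalarProduct g) (scalarProduct_nondegenerate g) φ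

/-- The linear maps `φ : 𝔤 → 𝔤` with image in `𝔥` that vanish on `𝔥 ⊕ 𝔲`, where `𝔲` is the
`B`-orthogonal complement of the centralizer of `𝔥`. -/
structure IsAdmissible [LieGroup 𝓘(ℝ, E) ∞ G]
    (B : LinearMap.BilinForm ℝ (GroupLieAlgebra 𝓘(ℝ, E) G))
    (h : Submodule ℝ (GroupLieAlgebra 𝓘(ℝ, E) G))
    (φ : GroupLieAlgebra 𝓘(ℝ, E) G →ₗ[ℝ] GroupLieAlgebra 𝓘(ℝ, E) G) : Prop where
  map_mem : ∀ X, φ X ∈ h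
  map_eq_zero : ∀ X ∈ h ⊔ B.orthogonal (centralizer h), φ X = 0

/-- The scalar product `(Id + φ)^* B`, that is, `(X, Y) ↦ B (X + φ X) (Y + φ Y)`. -/
def pullbackForm {V : Type*} [AddCommGroup V] [Module ℝ V] (B : LinearMap.BilinForm ℝ V)
    (φ : V →ₗ[ℝ] V) : LinearMap.BilinForm ℝ V :=
  B.compl₁₂ (LinearMap.id + φ) (LinearMap.id + φ)

end Group

end

end LeftInvariantRicci

open LeftInvariantRicci

/-
Transporting the metric `(1 + l)^* B` to `B` by the unipotent map `1 + l` conjugates the bracket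
instead, so that the Ricci tensor becomes a `B`-self-adjoint operator on the Lie algebra. With
`S = ∑ ad(j Z)²` and `N = ∑ ad Z ad(j Z)` over an orthonormal basis of `𝔥`, and `K` the operator of
the Killing form, it equals `½ S + N - ¼ (1 + l) K (1 + j)`. In the trace of its square, every term
other than `¼ tr S²` is a sum of values of symmetric multilinear forms in vectors of `𝔥`, built from
`j`. By polarization such a form is determined by its values at a single `Z ∈ 𝔥`, and there the
isometric automorphism `Ad_{a_Z}`, which fixes `𝔥` and sends `j' Z` to `j Z`, shows that it is the
same for `j` and `j'`. The trace of `S²` is not of this type: it involves `j` at two vectors, each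
quadratically.
-/

namespace LeftInvariantRicci

section LeftInvariantFields

variable {E : Type*} [NormedAddCommGroup E] [NormedSpace ℝ E]
  {G : Type*} [TopologicalSpace G] [ChartedSpace E G] [Group G]

local notation "𝔤" => GroupLieAlgebra 𝓘(ℝ, E) G

theorem mulInvariantVectorField_one (v : 𝔤) : mulInvariantVectorField v (1 : G) = v := by
  have h : (fun y : G ↦ 1 * y) = id := by ext; simp
  simp only [mulInvariantVectorField]
  rw [h, mfderiv_id]
  rfl

theorem mulInvariantVectorField_of_eq_one (v : 𝔤) {a : G} (ha : a = 1) :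
    (mulInvariantVectorField v a : E) = v := by
  subst ha
  exact mulInvariantVectorField_one v

theorem leftInvariantMetric_apply (B : LinearMap.BilinForm ℝ 𝔤) (x : G)
    (v w : TangentSpace 𝓘(ℝ, E) x) :
    leftInvariantMetric B x v w = B (toLieAlgebra x v) (toLieAlgebra x w) := rfl

variable [LieGroup 𝓘(ℝ, E) ∞ G]

theorem mdifferentiableAt_mul_left (a x : G) :
    MDifferentiableAt 𝓘(ℝ, E) 𝓘(ℝ, E) (fun y : G ↦ a * y) x :=
  (contMDiff_mul_left (I := 𝓘(ℝ, E)) (n := ∞) (a := a)).mdifferentiableAt (by simp)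

theorem mdifferentiableAt_mul_right (a x : G) :
    MDifferentiableAt 𝓘(ℝ, E) 𝓘(ℝ, E) (fun y : G ↦ y * a) x :=
  (contMDiff_mul_right (I := 𝓘(ℝ, E)) (n := ∞) (a := a)).mdifferentiableAt (by simp)

theorem toLieAlgebra_mulInvariantVectorField (x : G) (v : 𝔤) :
    toLieAlgebra x (mulInvariantVectorField v x) = v := by
  have h := mfderiv_comp_apply_of_eq (I'' := 𝓘(ℝ, E)) (1 : G)
    (mdifferentiableAt_mul_left x⁻¹ x) (mdifferentiableAt_mul_left x 1) (mul_one x) v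
  have hid : (fun y : G ↦ x⁻¹ * y) ∘ (fun y : G ↦ x * y) = id := by ext; simp
  rw [hid, mfderiv_id] at h
  exact h.symm

theorem mulInvariantVectorField_toLieAlgebra (x : G) (v : TangentSpace 𝓘(ℝ, E) x) :
    mulInvariantVectorField (toLieAlgebra x v) x = v := by
  have h := mfderiv_comp_apply_of_eq (I'' := 𝓘(ℝ, E)) x (mdifferentiableAt_mul_left x 1)
    (mdifferentiableAt_mul_left x⁻¹ x) (inv_mul_cancel x) v
  have hid : (fun y : G ↦ x * y) ∘ (fun y : G ↦ x⁻¹ * y) = id := by ext; simp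
  rw [hid, mfderiv_id] at h
  exact h.symm

/-- `(y, toLieAlgebra y (W y))` is the image of `(0_y, W y)` under the tangent map of division. -/
theorem mdifferentiableAt_totalSpaceMk_toLieAlgebra {W : ∀ x : G, TangentSpace 𝓘(ℝ, E) x} {x : G}
    (hW : MDifferentiableAt 𝓘(ℝ, E) (𝓘(ℝ, E).prod 𝓘(ℝ, E))
        (fun y ↦ (W y : TangentBundle 𝓘(ℝ, E) G)) x) :
    MDifferentiableAt 𝓘(ℝ, E) (𝓘(ℝ, E).prod 𝓘(ℝ, E)) (fun y ↦
      (TotalSpace.mk' E (1 : G) (toLieAlgebra y (W y)) : TangentBundle 𝓘(ℝ, E) G)) x := by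
  have hdiv : ContMDiff (𝓘(ℝ, E).prod 𝓘(ℝ, E)) 𝓘(ℝ, E) ∞ (fun p : G × G ↦ p.1⁻¹ * p.2) :=
    contMDiff_fst.inv.mul contMDiff_snd
  have hpair : MDifferentiableAt 𝓘(ℝ, E) ((𝓘(ℝ, E).prod 𝓘(ℝ, E)).prod (𝓘(ℝ, E).prod 𝓘(ℝ, E)))
      (fun y : G ↦ ((TotalSpace.mk' E y 0 : TangentBundle 𝓘(ℝ, E) G),
        (W y : TangentBundle 𝓘(ℝ, E) G))) x :=
    MDifferentiableAt.prodMk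
      ((contMDiff_zeroSection (n := 1) ℝ (fun x : G ↦ TangentSpace 𝓘(ℝ, E) x)).mdifferentiableAt
        (by simp)) hW
  have hsplit : ContMDiff ((𝓘(ℝ, E).prod 𝓘(ℝ, E)).prod (𝓘(ℝ, E).prod 𝓘(ℝ, E)))
      ((𝓘(ℝ, E).prod 𝓘(ℝ, E)).prod (𝓘(ℝ, E × E))) 1
      (equivTangentBundleProd 𝓘(ℝ, E) G 𝓘(ℝ, E) G).symm :=
    contMDiff_equivTangentBundleProd_symm
  have htangent := hdiv.contMDiff_tangentMap (m := 1) (by norm_cast)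
  convert (htangent.mdifferentiableAt (by simp)).comp x
    ((hsplit.mdifferentiableAt (by simp)).comp x hpair) using 1
  funext y
  simp only [Function.comp_apply, tangentMap]
  rw [mfderiv_prod_eq_add_apply (hdiv.mdifferentiableAt (by simp))]
  have hmk {a b : G} (hab : a = b) {v w : E} (hvw : v = w) :
      (TotalSpace.mk' E a v : TangentBundle 𝓘(ℝ, E) G) = TotalSpace.mk' E b w := by
    subst hab hvw; rfl
  refine hmk (inv_mul_cancel y).symm ?_
  simp +instances [toLieAlgebra, equivTangentBundleProd]
  rfl

theorem mdifferentiableAt_of_totalSpaceMk {N M : Type*} [TopologicalSpace N] [ChartedSpace E N]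
    [TopologicalSpace M] [ChartedSpace E M] [IsManifold 𝓘(ℝ, E) 1 M] {b : M} {f : N → E} {x : N}
    (hf : MDifferentiableAt 𝓘(ℝ, E) (𝓘(ℝ, E).prod 𝓘(ℝ, E))
      (fun y ↦ (TotalSpace.mk' E b (f y) : TangentBundle 𝓘(ℝ, E) M)) x) :
    MDifferentiableAt 𝓘(ℝ, E) 𝓘(ℝ, E) f x := by
  have hcoord : f = fun y ↦ (trivializationAt E (TangentSpace 𝓘(ℝ, E)) b
      (TotalSpace.mk' E b (f y))).2 := by
    funext y
    exact ((tangentBundleCore 𝓘(ℝ, E) M).coordChange_self (achart E b) b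
      (mem_achart_source E b) (f y)).symm
  rw [hcoord]
  exact ((mdifferentiableAt_totalSpace _ _).1 hf).2

theorem mdifferentiableAt_toLieAlgebra [FiniteDimensional ℝ E]
    (ℓ : 𝔤 →ₗ[ℝ] ℝ) {W : ∀ x : G, TangentSpace 𝓘(ℝ, E) x} {x : G}
    (hW : MDifferentiableAt 𝓘(ℝ, E) (𝓘(ℝ, E).prod 𝓘(ℝ, E))
        (fun y ↦ (W y : TangentBundle 𝓘(ℝ, E) G)) x) :
    MDifferentiableAt 𝓘(ℝ, E) 𝓘(ℝ, ℝ) (fun y : G ↦ ℓ (toLieAlgebra y (W y))) x :=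
  ((LinearMap.toContinuousLinearMap (show E →ₗ[ℝ] ℝ from ℓ)).mdifferentiableAt).comp x
    (mdifferentiableAt_of_totalSpaceMk (mdifferentiableAt_totalSpaceMk_toLieAlgebra hW))

theorem mlieBracket_mulInvariantVectorField [CompleteSpace E] (v w : 𝔤) :
    mlieBracket 𝓘(ℝ, E) (mulInvariantVectorField v) (mulInvariantVectorField w) =
      mulInvariantVectorField (G := G) ⁅v, w⁆ :=
  (mulInvariantVector_mlieBracket v w).symm

end LeftInvariantFields

theorem sum_coord_apply_eq_trace {R V ι : Type*} [CommRing R] [AddCommGroup V] [Module R V]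
    [Fintype ι] (e : Module.Basis ι R V) (f : Module.End R V) :
    ∑ i, e.coord i (f (e i)) = LinearMap.trace R V f := by
  classical
  simp [LinearMap.trace_eq_matrix_trace R e, Matrix.trace, LinearMap.toMatrix_apply]

theorem leviCivita_eq {E : Type*} [NormedAddCommGroup E] [NormedSpace ℝ E]
    {M : Type*} [TopologicalSpace M] [ChartedSpace E M] [IsManifold 𝓘(ℝ, E) ∞ M]
    (g : ∀ x : M, LinearMap.BilinForm ℝ (TangentSpace 𝓘(ℝ, E) x))
    (X Y : ∀ x : M, TangentSpace 𝓘(ℝ, E) x) {x : M} {v : TangentSpace 𝓘(ℝ, E) x}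
    (hg : ∀ u, (∀ W : ∀ x : M, TangentSpace 𝓘(ℝ, E) x,
      MDifferentiableAt 𝓘(ℝ, E) (𝓘(ℝ, E).prod 𝓘(ℝ, E))
        (fun y ↦ (W y : TangentBundle 𝓘(ℝ, E) M)) x → g x u (W x) = 0) → u = 0)
    (hv : ∀ W : ∀ x : M, TangentSpace 𝓘(ℝ, E) x,
      MDifferentiableAt 𝓘(ℝ, E) (𝓘(ℝ, E).prod 𝓘(ℝ, E))
        (fun y ↦ (W y : TangentBundle 𝓘(ℝ, E) M)) x → g x v (W x) = koszul g X Y W x) :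
    leviCivita g X Y x = v := by
  have hspec : ∀ W : ∀ x : M, TangentSpace 𝓘(ℝ, E) x,
      MDifferentiableAt 𝓘(ℝ, E) (𝓘(ℝ, E).prod 𝓘(ℝ, E))
        (fun y ↦ (W y : TangentBundle 𝓘(ℝ, E) M)) x →
      g x (leviCivita g X Y x) (W x) = koszul g X Y W x :=
    Classical.epsilon_spec (p := fun v : TangentSpace 𝓘(ℝ, E) x ↦
      ∀ W : ∀ x : M, TangentSpace 𝓘(ℝ, E) x,
        MDifferentiableAt 𝓘(ℝ, E) (𝓘(ℝ, E).prod 𝓘(ℝ, E))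
          (fun y ↦ (W y : TangentBundle 𝓘(ℝ, E) M)) x →
        g x v (W x) = koszul g X Y W x) ⟨v, hv⟩
  refine sub_eq_zero.1 (hg _ fun W hW ↦ ?_)
  rw [map_sub, LinearMap.sub_apply, hspec W hW, hv W hW, sub_self]

section LeftInvariantMetric

variable {E : Type*} [NormedAddCommGroup E] [NormedSpace ℝ E] [FiniteDimensional ℝ E]
  {G : Type*} [TopologicalSpace G] [ChartedSpace E G] [Group G] [LieGroup 𝓘(ℝ, E) ∞ G]

local notation "𝔤" => GroupLieAlgebra 𝓘(ℝ, E) G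

variable (B : LinearMap.BilinForm ℝ (GroupLieAlgebra 𝓘(ℝ, E) G))

theorem koszul_leftInvariantMetric (X Y : 𝔤) (W : ∀ x : G, TangentSpace 𝓘(ℝ, E) x) (x : G) :
    koszul (leftInvariantMetric B) (mulInvariantVectorField X) (mulInvariantVectorField Y) W x =
      1 / 2 * (mvfderiv 𝓘(ℝ, E) (fun y ↦ B Y (toLieAlgebra y (W y))) x (mulInvariantVectorField X x)
        + mvfderiv 𝓘(ℝ, E) (fun y ↦ B X (toLieAlgebra y (W y))) x (mulInvariantVectorField Y x)
        + B ⁅X, Y⁆ (toLieAlgebra x (W x))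
        - B (toLieAlgebra x (mlieBracket 𝓘(ℝ, E) (mulInvariantVectorField X) W x)) Y
        - B (toLieAlgebra x (mlieBracket 𝓘(ℝ, E) (mulInvariantVectorField Y) W x)) X) := by
  simp only [koszul, leftInvariantMetric_apply, toLieAlgebra_mulInvariantVectorField,
    mlieBracket_mulInvariantVectorField, mvfderiv_const, _root_.zero_apply, sub_zero]

theorem koszul_mulInvariantVectorField (X Y W : 𝔤) (x : G) :
    koszul (leftInvariantMetric B) (mulInvariantVectorField X) (mulInvariantVectorField Y)
      (mulInvariantVectorField W) x = 1 / 2 * (B ⁅X, Y⁆ W - B ⁅X, W⁆ Y - B ⁅Y, W⁆ X) := by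
  simp only [koszul_leftInvariantMetric, toLieAlgebra_mulInvariantVectorField,
    mlieBracket_mulInvariantVectorField, mvfderiv_const, _root_.zero_apply, add_zero, zero_add]

variable {B}

theorem tensorialAt_koszul (hB : B.IsSymm) (X Y : 𝔤) (x : G) :
    TensorialAt 𝓘(ℝ, E) E (fun W : ∀ x : G, TangentSpace 𝓘(ℝ, E) x ↦
      koszul (leftInvariantMetric B) (mulInvariantVectorField X) (mulInvariantVectorField Y) W x)
      x where
  smul := by
    intro f W hf hW
    have hd (Z : 𝔤) := mdifferentiableAt_toLieAlgebra (B Z) hW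
    have hmul (Z : 𝔤) : (fun y ↦ B Z (toLieAlgebra y ((f • W) y))) =
        f * fun y ↦ B Z (toLieAlgebra y (W y)) := by
      funext y; simp
    simp only [koszul_leftInvariantMetric, hmul]
    rw [mlieBracket_smul_right hf hW, mlieBracket_smul_right hf hW, mvfderiv_mul hf (hd _),
      mvfderiv_mul hf (hd _)]
    simp only [map_add, map_smul, LinearMap.add_apply, LinearMap.smul_apply,
      _root_.add_apply, _root_.smul_apply, smul_eq_mul, Pi.smul_apply',
      hB.eq (toLieAlgebra x (W x))]
    ring
  add := by
    intro W W' hW hW'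
    have hd (Z : 𝔤) := mdifferentiableAt_toLieAlgebra (B Z) hW
    have hd' (Z : 𝔤) := mdifferentiableAt_toLieAlgebra (B Z) hW'
    have hadd (Z : 𝔤) : (fun y ↦ B Z (toLieAlgebra y ((W + W') y))) =
        (fun y ↦ B Z (toLieAlgebra y (W y))) + fun y ↦ B Z (toLieAlgebra y (W' y)) := by
      funext y; simp
    simp only [koszul_leftInvariantMetric, hadd]
    rw [mlieBracket_add_right hW hW', mlieBracket_add_right hW hW', mvfderiv_add (hd _) (hd' _),
      mvfderiv_add (hd _) (hd' _)]
    simp only [map_add, LinearMap.add_apply, _root_.add_apply, Pi.add_apply]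
    ring

theorem leviCivita_leftInvariantMetric (hB : B.Nondegenerate) (hs : B.IsSymm) {X Y V : 𝔤}
    (hV : ∀ W, B V W = 1 / 2 * (B ⁅X, Y⁆ W - B ⁅X, W⁆ Y - B ⁅Y, W⁆ X)) :
    leviCivita (leftInvariantMetric B) (mulInvariantVectorField X) (mulInvariantVectorField Y) =
      mulInvariantVectorField (G := G) V := by
  funext x
  refine leviCivita_eq _ _ _ (fun u hu ↦ ?_) fun W hW ↦ ?_
  · have h0 : toLieAlgebra x u = 0 := hB.1 _ fun W ↦ by
      simpa only [leftInvariantMetric_apply, toLieAlgebra_mulInvariantVectorField] using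
        hu (mulInvariantVectorField W) (mdifferentiableAt_mulInvariantVectorField W)
    rw [← mulInvariantVectorField_toLieAlgebra x u, h0]
    exact map_zero (mfderiv 𝓘(ℝ, E) 𝓘(ℝ, E) (fun y : G ↦ x * y) 1)
  · rw [(tensorialAt_koszul hs X Y x).pointwise hW
      (mdifferentiableAt_mulInvariantVectorField (toLieAlgebra x (W x)))
      (mulInvariantVectorField_toLieAlgebra x (W x)).symm, koszul_mulInvariantVectorField,
      leftInvariantMetric_apply, toLieAlgebra_mulInvariantVectorField, hV]

theorem ricci_leftInvariantMetric (hB : B.Nondegenerate) (hs : B.IsSymm)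
    (D : 𝔤 →ₗ[ℝ] 𝔤 →ₗ[ℝ] 𝔤)
    (hD : ∀ X Y W, B (D X Y) W = 1 / 2 * (B ⁅X, Y⁆ W - B ⁅X, W⁆ Y - B ⁅Y, W⁆ X))
    (htr : ∀ W, LinearMap.trace ℝ _ (D.flip W) = 0) (v w : 𝔤) :
    ricci (leftInvariantMetric B) v w = - LinearMap.trace ℝ _ (D.flip w * D.flip v) := by
  have hLC (X Y : 𝔤) : leviCivita (leftInvariantMetric B) (mulInvariantVectorField X)
      (mulInvariantVectorField Y) = mulInvariantVectorField (G := G) (D X Y) :=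
    leviCivita_leftInvariantMetric hB hs (hD X Y)
  have htorsion (X Y : 𝔤) : ⁅X, Y⁆ = D X Y - D Y X := by
    refine sub_eq_zero.1 (hB.1 _ fun W ↦ ?_)
    simp only [map_sub, LinearMap.sub_apply, hD]
    rw [← lie_skew X Y, map_neg, LinearMap.neg_apply]
    ring
  have hcurv (X : 𝔤) : curvature (leftInvariantMetric B) (mulInvariantVectorField X)
      (mulInvariantVectorField v) (mulInvariantVectorField w) (1 : G) =
      (D.flip (D v w) - D v * D.flip w - (D.flip w * D.flip v - D.flip w * D v)) X := by
    simp only [curvature, hLC, mlieBracket_mulInvariantVectorField, mulInvariantVectorField_one]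
    simp [htorsion]
  simp only [ricci, hcurv]
  refine (sum_coord_apply_eq_trace _ _).trans ?_
  rw [map_sub, map_sub, map_sub, htr, LinearMap.trace_mul_comm ℝ (D v)]
  ring

end LeftInvariantMetric

section Adjoint

variable {E : Type*} [NormedAddCommGroup E] [NormedSpace ℝ E]
  {G : Type*} [TopologicalSpace G] [ChartedSpace E G] [Group G]

local notation "𝔤" => GroupLieAlgebra 𝓘(ℝ, E) G

theorem Ad_apply (a : G) (v : 𝔤) :
    Ad a v = mfderiv 𝓘(ℝ, E) 𝓘(ℝ, E) (fun x : G ↦ a * x * a⁻¹) 1 v := rfl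

theorem Ad_one (v : 𝔤) : Ad (1 : G) v = v := by
  have hid : (fun y : G ↦ 1 * y * 1⁻¹) = id := by ext; simp
  rw [Ad_apply, hid, mfderiv_id]
  rfl

/-- The orbit map `x ↦ Ad x w` of the adjoint representation. Its values lie in the model space `E`,
which is the type of `𝔤` and carries a norm. -/
noncomputable def adOrbit (w : 𝔤) (x : G) : E := Ad x w

theorem adOrbit_one (w : 𝔤) : adOrbit w (1 : G) = w := Ad_one w

variable [LieGroup 𝓘(ℝ, E) ∞ G]

theorem contMDiff_conj (a : G) : ContMDiff 𝓘(ℝ, E) 𝓘(ℝ, E) ∞ (fun x : G ↦ a * x * a⁻¹) :=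
  (contMDiff_mul_left (I := 𝓘(ℝ, E)) (n := ∞) (a := a)).mul contMDiff_const

theorem mdifferentiableAt_conj (a x : G) :
    MDifferentiableAt 𝓘(ℝ, E) 𝓘(ℝ, E) (fun y : G ↦ a * y * a⁻¹) x :=
  (contMDiff_conj a).mdifferentiableAt (by simp)

theorem Ad_inv_Ad (a : G) (v : 𝔤) : Ad a⁻¹ (Ad a v) = v := by
  have h := mfderiv_comp_apply_of_eq (I'' := 𝓘(ℝ, E)) (1 : G) (mdifferentiableAt_conj a⁻¹ 1)
    (mdifferentiableAt_conj a 1) (by simp) v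
  have hid : (fun y : G ↦ a⁻¹ * y * a⁻¹⁻¹) ∘ (fun y : G ↦ a * y * a⁻¹) = id := by
    ext; simp [mul_assoc]
  rw [hid, mfderiv_id] at h
  exact h.symm

theorem mfderiv_mul_right_Ad (a : G) (v : 𝔤) :
    mfderiv 𝓘(ℝ, E) 𝓘(ℝ, E) (fun y : G ↦ y * a) 1 (Ad a v) =
      mfderiv 𝓘(ℝ, E) 𝓘(ℝ, E) (fun y : G ↦ a * y) 1 v := by
  have h := mfderiv_comp_apply_of_eq (I'' := 𝓘(ℝ, E)) (1 : G) (mdifferentiableAt_mul_right a 1)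
    (mdifferentiableAt_conj a 1) (by simp) v
  have hcomp : (fun y : G ↦ y * a) ∘ (fun y : G ↦ a * y * a⁻¹) = fun y ↦ a * y := by ext; simp
  rw [hcomp] at h
  exact h.symm

theorem mfderiv_conj_mulInvariantVectorField (a x : G) (v : 𝔤) :
    mfderiv 𝓘(ℝ, E) 𝓘(ℝ, E) (fun y : G ↦ a * y * a⁻¹) x (mulInvariantVectorField v x) =
      mulInvariantVectorField (Ad a v) (a * x * a⁻¹) := by
  have hleft := mfderiv_comp_apply_of_eq (I'' := 𝓘(ℝ, E)) (1 : G) (mdifferentiableAt_conj a x)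
    (mdifferentiableAt_mul_left x 1) (mul_one x) v
  have hright := mfderiv_comp_apply_of_eq (I'' := 𝓘(ℝ, E)) (1 : G)
    (mdifferentiableAt_mul_left (a * x * a⁻¹) 1) (mdifferentiableAt_conj a 1) (by simp) v
  have hcomp : (fun y : G ↦ a * y * a⁻¹) ∘ (fun y : G ↦ x * y) =
      (fun y : G ↦ a * x * a⁻¹ * y) ∘ (fun y : G ↦ a * y * a⁻¹) := by
    ext y; simp [mul_assoc]
  rw [hcomp] at hleft
  exact hleft.symm.trans hright

theorem isInvertible_mfderiv_conj (a x : G) :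
    (mfderiv 𝓘(ℝ, E) 𝓘(ℝ, E) (fun y : G ↦ a * y * a⁻¹) x).IsInvertible := by
  let Φ : Diffeomorph 𝓘(ℝ, E) 𝓘(ℝ, E) G G ∞ :=
    { toEquiv := (MulAut.conj a).toEquiv
      contMDiff_toFun := contMDiff_conj a
      contMDiff_invFun := by simpa using! contMDiff_conj (E := E) a⁻¹ }
  exact ⟨Φ.mfderivToContinuousLinearEquiv (by simp) x, rfl⟩

theorem mpullback_conj_mulInvariantVectorField (a : G) (v : 𝔤) :
    mpullback 𝓘(ℝ, E) 𝓘(ℝ, E) (fun y : G ↦ a * y * a⁻¹) (mulInvariantVectorField (Ad a v)) =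
      mulInvariantVectorField v := by
  funext x
  rw [mpullback_apply, ← mfderiv_conj_mulInvariantVectorField]
  exact (isInvertible_mfderiv_conj a x).inverse_apply_self _

theorem Ad_lie [CompleteSpace E] (a : G) (v w : 𝔤) : Ad a ⁅v, w⁆ = ⁅Ad a v, Ad a w⁆ := by
  have h := mpullback_mlieBracket (I := 𝓘(ℝ, E)) (I' := 𝓘(ℝ, E)) (n := ∞)
    (f := fun y : G ↦ a * y * a⁻¹) (x₀ := (1 : G))
    (mdifferentiableAt_mulInvariantVectorField (Ad a v))
    (mdifferentiableAt_mulInvariantVectorField (Ad a w)) (contMDiff_conj a).contMDiffAt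
    (by simpa using! ENat.LEInfty.out)
  rw [mpullback_conj_mulInvariantVectorField, mpullback_conj_mulInvariantVectorField,
    mlieBracket_mulInvariantVectorField, mlieBracket_mulInvariantVectorField, mpullback_apply,
    mulInvariantVectorField_one] at h
  rw [← h, Ad_apply, (isInvertible_mfderiv_conj a 1).self_apply_inverse]
  exact mulInvariantVectorField_of_eq_one _ (by simp)

theorem scalarProduct_Ad_Ad {g : ContMDiffRiemannianMetric 𝓘(ℝ, E) ∞ E
    (fun x : G ↦ TangentSpace 𝓘(ℝ, E) x)} (hg : IsBiInvariant g) (a : G) (v w : 𝔤) :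
    scalarProduct g (Ad a v) (Ad a w) = scalarProduct g v w := by
  have hcongr {b c : G} (hbc : b = c) (v w : E) : g.inner b v w = g.inner c v w := by
    subst hbc; rfl
  calc g.inner 1 (Ad a v) (Ad a w)
      = g.inner (1 * a) (mfderiv 𝓘(ℝ, E) 𝓘(ℝ, E) (fun y : G ↦ y * a) 1 (Ad a v))
          (mfderiv 𝓘(ℝ, E) 𝓘(ℝ, E) (fun y : G ↦ y * a) 1 (Ad a w)) := (hg.2 a 1 _ _).symm
    _ = g.inner (a * 1) (mfderiv 𝓘(ℝ, E) 𝓘(ℝ, E) (fun y : G ↦ a * y) 1 v)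
          (mfderiv 𝓘(ℝ, E) 𝓘(ℝ, E) (fun y : G ↦ a * y) 1 w) := by
      rw [mfderiv_mul_right_Ad, mfderiv_mul_right_Ad]
      exact hcongr (by simp) _ _
    _ = g.inner 1 v w := hg.1 a 1 v w

end Adjoint

theorem fderiv_apply_prodMk_zero {𝕜 V V' W : Type*} [NontriviallyNormedField 𝕜]
    [NormedAddCommGroup V] [NormedSpace 𝕜 V] [NormedAddCommGroup V'] [NormedSpace 𝕜 V']
    [NormedAddCommGroup W] [NormedSpace 𝕜 W] {f : V × V' → W} {p : V} {q : V'}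
    (hf : DifferentiableAt 𝕜 f (p, q)) (v : V) :
    fderiv 𝕜 f (p, q) (v, 0) = fderiv 𝕜 (fun x ↦ f (x, q)) p v := by
  have h := hf.hasFDerivAt.comp (f := fun x ↦ (x, q)) p (hasFDerivAt_prodMk_left p q)
  exact (DFunLike.congr_fun h.fderiv v).symm

theorem fderiv_apply_zero_prodMk {𝕜 V V' W : Type*} [NontriviallyNormedField 𝕜]
    [NormedAddCommGroup V] [NormedSpace 𝕜 V] [NormedAddCommGroup V'] [NormedSpace 𝕜 V']
    [NormedAddCommGroup W] [NormedSpace 𝕜 W] {f : V × V' → W} {p : V} {q : V'}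
    (hf : DifferentiableAt 𝕜 f (p, q)) (v : V') :
    fderiv 𝕜 f (p, q) (0, v) = fderiv 𝕜 (fun x ↦ f (p, x)) q v := by
  have h := hf.hasFDerivAt.comp (f := fun x ↦ (p, x)) q (hasFDerivAt_prodMk_right p q)
  exact (DFunLike.congr_fun h.fderiv v).symm

section ChartMul

variable {E : Type*} [NormedAddCommGroup E] [NormedSpace ℝ E]
  {G : Type*} [TopologicalSpace G] [ChartedSpace E G] [Group G]

local notation "𝔤" => GroupLieAlgebra 𝓘(ℝ, E) G

local notation "φ" => extChartAt 𝓘(ℝ, E) (1 : G)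

theorem mfderiv_one_eq_fderiv {f : G → E} (hf : MDifferentiableAt 𝓘(ℝ, E) 𝓘(ℝ, E) f 1) :
    mfderiv 𝓘(ℝ, E) 𝓘(ℝ, E) f 1 = fderiv ℝ (fun p ↦ f ((φ).symm p)) (φ 1) := by
  rw [hf.mfderiv]
  simp only [ModelWithCorners.range_eq_univ, fderivWithin_univ]
  rfl

variable (E G) in
/-- The multiplication of `G` read in the preferred chart at the identity. -/
noncomputable def chartMul (p : E × E) : E := φ ((φ).symm p.1 * (φ).symm p.2)

variable [LieGroup 𝓘(ℝ, E) ∞ G]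

theorem contDiffAt_chartMul {p : E × E} (h₁ : p.1 ∈ (φ).target) (h₂ : p.2 ∈ (φ).target)
    (h₁₂ : (φ).symm p.1 * (φ).symm p.2 ∈ (φ).source) : ContDiffAt ℝ ∞ (chartMul E G) p := by
  rw [← contMDiffAt_iff_contDiffAt]
  have hsymm (q : E) (hq : q ∈ (φ).target) : ContMDiffAt 𝓘(ℝ, E) 𝓘(ℝ, E) ∞ (φ).symm q :=
    (contMDiffOn_extChartAt_symm (1 : G)).contMDiffAt
      ((isOpen_extChartAt_target (1 : G)).mem_nhds hq)
  have hmul : ContMDiffAt 𝓘(ℝ, E × E) 𝓘(ℝ, E) ∞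
      (fun p : E × E ↦ (φ).symm p.1 * (φ).symm p.2) p :=
    ((hsymm _ h₁).comp p contDiff_fst.contMDiff.contMDiffAt).mul
      ((hsymm _ h₂).comp p contDiff_snd.contMDiff.contMDiffAt)
  exact (contMDiffAt_extChartAt' (by simpa using h₁₂)).comp p hmul

theorem contDiffAt_chartMul_right {p : E} (hp : p ∈ (φ).target) :
    ContDiffAt ℝ ∞ (chartMul E G) (p, φ 1) :=
  contDiffAt_chartMul hp (mem_extChartAt_target 1)
    (by simpa only [extChartAt_to_inv, mul_one] using (φ).map_target hp)

theorem contDiffAt_chartMul_left {p : E} (hp : p ∈ (φ).target) :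
    ContDiffAt ℝ ∞ (chartMul E G) (φ 1, p) :=
  contDiffAt_chartMul (mem_extChartAt_target 1) hp
    (by simpa only [extChartAt_to_inv, one_mul] using (φ).map_target hp)

theorem fderiv_chartMul_right {p : E} (hp : p ∈ (φ).target) (v : E) :
    fderiv ℝ (chartMul E G) (p, φ 1) (0, v) =
      mfderiv 𝓘(ℝ, E) 𝓘(ℝ, E) (φ) ((φ).symm p) (mulInvariantVectorField v ((φ).symm p)) := by
  have hφ : MDifferentiableAt 𝓘(ℝ, E) 𝓘(ℝ, E) (φ) ((φ).symm p) :=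
    mdifferentiableAt_extChartAt (by simpa using (φ).map_target hp)
  have hmul := mdifferentiableAt_mul_left (E := E) ((φ).symm p) 1
  have hcomp := mfderiv_comp_apply_of_eq (I'' := 𝓘(ℝ, E)) (1 : G) hφ hmul (mul_one _) v
  rw [mfderiv_one_eq_fderiv (hφ.comp_of_eq (1 : G) hmul (mul_one _))] at hcomp
  rw [fderiv_apply_zero_prodMk ((contDiffAt_chartMul_right hp).differentiableAt (by simp))]
  exact hcomp

theorem fderiv_chartMul_left {p : E} (hp : p ∈ (φ).target) (v : E) :
    fderiv ℝ (chartMul E G) (φ 1, p) (v, 0) =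
      mfderiv 𝓘(ℝ, E) 𝓘(ℝ, E) (φ) ((φ).symm p)
        (mfderiv 𝓘(ℝ, E) 𝓘(ℝ, E) (fun y ↦ y * (φ).symm p) (1 : G) v) := by
  have hφ : MDifferentiableAt 𝓘(ℝ, E) 𝓘(ℝ, E) (φ) ((φ).symm p) :=
    mdifferentiableAt_extChartAt (by simpa using (φ).map_target hp)
  have hmul := mdifferentiableAt_mul_right (E := E) ((φ).symm p) 1
  have hcomp := mfderiv_comp_apply_of_eq (I'' := 𝓘(ℝ, E)) (1 : G) hφ hmul (one_mul _) v
  rw [mfderiv_one_eq_fderiv (hφ.comp_of_eq (1 : G) hmul (one_mul _))] at hcomp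
  rw [fderiv_apply_prodMk_zero ((contDiffAt_chartMul_left hp).differentiableAt (by simp))]
  exact hcomp

theorem fderiv_chartMul_Ad {p : E} (hp : p ∈ (φ).target) (v : 𝔤) :
    fderiv ℝ (chartMul E G) (φ 1, p) (Ad ((φ).symm p) v, 0) =
      fderiv ℝ (chartMul E G) (p, φ 1) (0, v) :=
  (fderiv_chartMul_left hp _).trans <|
    (congrArg (mfderiv 𝓘(ℝ, E) 𝓘(ℝ, E) (φ) ((φ).symm p))
      (mfderiv_mul_right_Ad ((φ).symm p) v)).trans (fderiv_chartMul_right hp v).symm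

theorem fderiv_chartMul_one_left (v : E) : fderiv ℝ (chartMul E G) (φ 1, φ 1) (v, 0) = v := by
  have hid : (fun p ↦ chartMul E G (p, φ 1)) =ᶠ[nhds (φ 1)] id := by
    filter_upwards [extChartAt_target_mem_nhds (1 : G)] with p hp
    simpa only [chartMul, extChartAt_to_inv, mul_one, id_eq] using (φ).right_inv hp
  have hmul : DifferentiableAt ℝ (chartMul E G) (φ 1, φ 1) :=
    (contDiffAt_chartMul_right (mem_extChartAt_target 1)).differentiableAt (by simp)
  rw [fderiv_apply_prodMk_zero hmul, hid.fderiv_eq, fderiv_id, ContinuousLinearMap.id_apply]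

theorem fderiv_chartMul_one_right (v : E) : fderiv ℝ (chartMul E G) (φ 1, φ 1) (0, v) = v := by
  have hid : (fun p ↦ chartMul E G (φ 1, p)) =ᶠ[nhds (φ 1)] id := by
    filter_upwards [extChartAt_target_mem_nhds (1 : G)] with p hp
    simpa only [chartMul, extChartAt_to_inv, one_mul, id_eq] using (φ).right_inv hp
  have hmul : DifferentiableAt ℝ (chartMul E G) (φ 1, φ 1) :=
    (contDiffAt_chartMul_left (mem_extChartAt_target 1)).differentiableAt (by simp)
  rw [fderiv_apply_zero_prodMk hmul, hid.fderiv_eq, fderiv_id, ContinuousLinearMap.id_apply]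

theorem hasFDerivAt_fderiv_chartMul :
    HasFDerivAt (fderiv ℝ (chartMul E G)) (fderiv ℝ (fderiv ℝ (chartMul E G)) (φ 1, φ 1))
      (φ 1, φ 1) :=
  (((contDiffAt_chartMul_right (mem_extChartAt_target 1)).fderiv_right (m := 1)
    (by norm_cast)).differentiableAt (by simp)).hasFDerivAt

theorem hasFDerivAt_fderiv_chartMul_left (u : E × E) :
    HasFDerivAt (fun p ↦ fderiv ℝ (chartMul E G) (p, φ 1) u)
      (((ContinuousLinearMap.apply ℝ E u).comp
        (fderiv ℝ (fderiv ℝ (chartMul E G)) (φ 1, φ 1))).comp (ContinuousLinearMap.inl ℝ E E))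
      (φ 1) :=
  (ContinuousLinearMap.apply ℝ E u).hasFDerivAt.comp (φ 1)
    (hasFDerivAt_fderiv_chartMul.comp (f := fun p ↦ (p, φ 1)) (φ 1)
      (hasFDerivAt_prodMk_left (φ 1) (φ 1)))

theorem hasFDerivAt_fderiv_chartMul_right :
    HasFDerivAt (fun p ↦ (fderiv ℝ (chartMul E G) (φ 1, p)).comp (ContinuousLinearMap.inl ℝ E E))
      ((((ContinuousLinearMap.compL ℝ E (E × E) E).flip (ContinuousLinearMap.inl ℝ E E)).comp
        (fderiv ℝ (fderiv ℝ (chartMul E G)) (φ 1, φ 1))).comp (ContinuousLinearMap.inr ℝ E E))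
      (φ 1) :=
  ((ContinuousLinearMap.compL ℝ E (E × E) E).flip (ContinuousLinearMap.inl ℝ E E)).hasFDerivAt.comp
    (φ 1) (hasFDerivAt_fderiv_chartMul.comp (f := fun p ↦ (φ 1, p)) (φ 1)
      (hasFDerivAt_prodMk_right (φ 1) (φ 1)))

theorem mpullbackWithin_extChartAt_symm_mulInvariantVectorField (v : 𝔤) {p : E}
    (hp : p ∈ (φ).target) :
    mpullbackWithin 𝓘(ℝ, E) 𝓘(ℝ, E) (φ).symm (mulInvariantVectorField v) (Set.range 𝓘(ℝ, E)) p =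
      fderiv ℝ (chartMul E G) (p, φ 1) (0, v) := by
  refine Eq.trans ?_ (fderiv_chartMul_right hp v).symm
  rw [mpullbackWithin_apply,
    ContinuousLinearMap.inverse_eq (mfderivWithin_extChartAt_symm_comp_mfderiv_extChartAt hp)
      (mfderiv_extChartAt_comp_mfderivWithin_extChartAt_symm hp)]
  rfl

end ChartMul

section DerivativeOfAd

variable {E : Type*} [NormedAddCommGroup E] [NormedSpace ℝ E]
  {G : Type*} [TopologicalSpace G] [ChartedSpace E G] [Group G] [LieGroup 𝓘(ℝ, E) ∞ G]

local notation "𝔤" => GroupLieAlgebra 𝓘(ℝ, E) G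

local notation "φ" => extChartAt 𝓘(ℝ, E) (1 : G)

theorem lie_eq_fderiv_fderiv_chartMul (v w : 𝔤) :
    ⁅v, w⁆ = fderiv ℝ (fderiv ℝ (chartMul E G)) (φ 1, φ 1) (v, 0) (0, w) -
      fderiv ℝ (fderiv ℝ (chartMul E G)) (φ 1, φ 1) (w, 0) (0, v) := by
  let V (u : E) (p : E) : E := fderiv ℝ (chartMul E G) (p, φ 1) (0, u)
  have hV (u : 𝔤) : mpullbackWithin 𝓘(ℝ, E) 𝓘(ℝ, E) (φ).symm (mulInvariantVectorField u)
      (Set.range 𝓘(ℝ, E)) =ᶠ[nhds (φ 1)] V u := by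
    filter_upwards [extChartAt_target_mem_nhds (1 : G)] with p hp
    exact mpullbackWithin_extChartAt_symm_mulInvariantVectorField u hp
  have hV1 (u : E) : V u (φ 1) = u := fderiv_chartMul_one_right u
  have hdV (u : E) : fderiv ℝ (V u) (φ 1) = _ :=
    (hasFDerivAt_fderiv_chartMul_left ((0, u) : E × E)).fderiv
  have hinverse (z : E) : (mfderiv 𝓘(ℝ, E) 𝓘(ℝ, E) (φ) 1).inverse z = z := by
    have hid : (mfderiv 𝓘(ℝ, E) 𝓘(ℝ, E) (φ) 1 : E →L[ℝ] E) = ContinuousLinearMap.id ℝ E :=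
      mfderiv_extChartAt_self
    exact (congrArg (fun L : E →L[ℝ] E ↦ L.inverse z) hid).trans (by simp)
  have hbracket (u u' : E) : lieBracketWithin ℝ (V u) (V u') Set.univ (φ 1) =
      fderiv ℝ (fderiv ℝ (chartMul E G)) (φ 1, φ 1) (u, 0) (0, u') -
      fderiv ℝ (fderiv ℝ (chartMul E G)) (φ 1, φ 1) (u', 0) (0, u) := by
    rw [lieBracketWithin_univ, lieBracket, hV1, hV1, hdV, hdV]
    rfl
  rw [GroupLieAlgebra.bracket_def, ← mlieBracketWithin_univ, mlieBracketWithin_apply]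
  refine (hinverse _).trans (Eq.trans ?_ (hbracket v w))
  rw [Set.preimage_univ, Set.univ_inter]
  simp only [ModelWithCorners.range_eq_univ] at hV ⊢
  exact (hV v).lieBracketWithin_vectorField_eq_nhds (hV w)

variable [CompleteSpace E]

theorem differentiableAt_adOrbit_comp_symm (w : 𝔤) :
    DifferentiableAt ℝ (adOrbit w ∘ (φ).symm) (φ 1) := by
  let P (p : E) : E →L[ℝ] E :=
    (fderiv ℝ (chartMul E G) (φ 1, p)).comp (ContinuousLinearMap.inl ℝ E E)
  have hP : DifferentiableAt ℝ P (φ 1) := hasFDerivAt_fderiv_chartMul_right.differentiableAt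
  have hP1 : P (φ 1) = ContinuousLinearEquiv.refl ℝ E := by
    ext v; exact fderiv_chartMul_one_left v
  have hinverse : DifferentiableAt ℝ (fun p ↦ (P p).inverse) (φ 1) := by
    refine DifferentiableAt.comp (g := ContinuousLinearMap.inverse) (φ 1) ?_ hP
    rw [hP1]
    exact (contDiffAt_map_inverse (n := 1) (ContinuousLinearEquiv.refl ℝ E)).differentiableAt
      (by simp)
  refine (hinverse.clm_apply (hasFDerivAt_fderiv_chartMul_left
    ((0, w) : E × E)).differentiableAt).congr_of_eventuallyEq ?_
  filter_upwards [extChartAt_target_mem_nhds (1 : G),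
    hP.continuousAt (by rw [hP1]; exact ContinuousLinearEquiv.nhds _)] with p hp ⟨e, he⟩
  have hw : P p (adOrbit w ((φ).symm p)) = _ := fderiv_chartMul_Ad hp w
  rw [← hw, ← he, ContinuousLinearMap.inverse_equiv]
  exact (e.symm_apply_apply _).symm

theorem fderiv_adOrbit_comp_symm (v w : 𝔤) :
    fderiv ℝ (adOrbit w ∘ (φ).symm) (φ 1) v = ⁅v, w⁆ := by
  let f : E → E := adOrbit w ∘ (φ).symm
  let D := fderiv ℝ (fderiv ℝ (chartMul E G)) (φ 1, φ 1)
  have hf1 : f (φ 1) = w :=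
    (congrArg (adOrbit w) (extChartAt_to_inv 1)).trans (adOrbit_one w)
  have hmul : (fun p ↦ fderiv ℝ (chartMul E G) (φ 1, p) (f p, 0)) =ᶠ[nhds (φ 1)]
      fun p ↦ fderiv ℝ (chartMul E G) (p, φ 1) (0, w) := by
    filter_upwards [extChartAt_target_mem_nhds (1 : G)] with p hp
    exact fderiv_chartMul_Ad hp w
  have hleibniz : fderiv ℝ (chartMul E G) (φ 1, φ 1) (fderiv ℝ f (φ 1) v, 0) +
      D (0, (v : E)) (f (φ 1), 0) = D ((v : E), 0) (0, (w : E)) :=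
    DFunLike.congr_fun ((hasFDerivAt_fderiv_chartMul_right.clm_apply
      (differentiableAt_adOrbit_comp_symm w).hasFDerivAt).unique
      ((hasFDerivAt_fderiv_chartMul_left ((0, w) : E × E)).congr_of_eventuallyEq hmul)) (v : E)
  have hsymm : IsSymmSndFDerivAt ℝ (chartMul E G) (φ 1, φ 1) :=
    (contDiffAt_chartMul_right (mem_extChartAt_target 1)).isSymmSndFDerivAt
      (by simpa using! ENat.LEInfty.out)
  rw [fderiv_chartMul_one_left, hf1, hsymm.eq] at hleibniz
  exact (eq_sub_of_add_eq hleibniz).trans (lie_eq_fderiv_fderiv_chartMul v w).symm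

theorem mdifferentiableAt_adOrbit (w : 𝔤) :
    MDifferentiableAt 𝓘(ℝ, E) 𝓘(ℝ, E) (adOrbit w) (1 : G) := by
  rw [mdifferentiableAt_iff_source_of_mem_source (mem_chart_source E 1),
    ModelWithCorners.range_eq_univ, mdifferentiableWithinAt_univ]
  exact (differentiableAt_adOrbit_comp_symm w).mdifferentiableAt

theorem mfderiv_adOrbit (v w : 𝔤) :
    mfderiv 𝓘(ℝ, E) 𝓘(ℝ, E) (adOrbit w) (1 : G) v = ⁅v, w⁆ := by
  rw [mfderiv_one_eq_fderiv (mdifferentiableAt_adOrbit w)]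
  exact fderiv_adOrbit_comp_symm v w

theorem lie_differential_eq_zero {F : Type*} [NormedAddCommGroup F] [NormedSpace ℝ F]
    {H : Type*} [TopologicalSpace H] [ChartedSpace F H] [CommGroup H] (i : H →* G)
    (hi : MDifferentiableAt 𝓘(ℝ, F) 𝓘(ℝ, E) i 1) (v w : GroupLieAlgebra 𝓘(ℝ, F) H) :
    ⁅differential (E := E) i v, differential (E := E) i w⁆ = 0 := by
  let w' : E := differential (E := E) i w
  have hAd (x : H) : adOrbit w' (i x) = w' := by
    have h := mfderiv_comp_apply_of_eq (I'' := 𝓘(ℝ, E)) (1 : H) (mdifferentiableAt_conj (i x) 1)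
      hi (map_one i) w
    have hcomp : (fun y : G ↦ i x * y * (i x)⁻¹) ∘ i = i := by
      ext y; simp [← map_mul, ← map_inv, mul_comm x y]
    rw [hcomp] at h
    exact h.symm
  have h := mfderiv_comp_apply_of_eq (I'' := 𝓘(ℝ, E)) (1 : H) (mdifferentiableAt_adOrbit w') hi
    (map_one i) v
  have hconst : adOrbit w' ∘ i = fun _ ↦ w' := funext hAd
  rw [hconst, mfderiv_const] at h
  exact (h.trans (mfderiv_adOrbit (differential (E := E) i v) w')).symm

theorem lieInvariant_of_Ad_Ad [FiniteDimensional ℝ E]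
    {B : LinearMap.BilinForm ℝ (GroupLieAlgebra 𝓘(ℝ, E) G)}
    (hB : ∀ (a : G) (v w : 𝔤), B (Ad a v) (Ad a w) = B v w) : B.lieInvariant 𝔤 := by
  intro u v w
  let f (w : 𝔤) : E → E := adOrbit w ∘ (φ).symm
  have hf (w : 𝔤) : HasFDerivAt (f w) (fderiv ℝ (f w) (φ 1)) (φ 1) :=
    (differentiableAt_adOrbit_comp_symm w).hasFDerivAt
  have hf1 (w : 𝔤) : f w (φ 1) = w :=
    (congrArg (adOrbit w) (extChartAt_to_inv 1)).trans (adOrbit_one w)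
  let b : E →L[ℝ] E →L[ℝ] ℝ := LinearMap.toContinuousBilinearMap (𝕜 := ℝ) (E := E) (F := E) B
  have hleibniz : b (f v (φ 1)) (fderiv ℝ (f w) (φ 1) u) +
      b (fderiv ℝ (f v) (φ 1) u) (f w (φ 1)) = 0 :=
    DFunLike.congr_fun ((b.hasFDerivAt_of_bilinear (hf v) (hf w)).unique
      ((hasFDerivAt_const (B v w) (φ 1)).congr_of_eventuallyEq
        (Filter.Eventually.of_forall fun p ↦ hB ((φ).symm p) v w))) (u : E)
  rw [hf1, hf1, fderiv_adOrbit_comp_symm, fderiv_adOrbit_comp_symm] at hleibniz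
  exact eq_neg_of_add_eq_zero_right hleibniz

end DerivativeOfAd

section BilinearForms

open Module (End)

theorem sum_mul_mul_mul_eq_trace {n R : Type*} [Fintype n] [CommRing R] {P Q : Matrix n n R}
    (hP : P.IsSymm) (hQ : Q.IsSymm) :
    ∑ i, ∑ j, ∑ k, ∑ l, P i k * P j l * Q i j * Q k l = (P * Q * (P * Q)).trace := by
  calc ∑ i, ∑ j, ∑ k, ∑ l, P i k * P j l * Q i j * Q k l
      = ∑ k, ∑ j, ∑ i, ∑ l, P i k * P j l * Q i j * Q k l := by
        rw [Finset.sum_congr rfl fun i _ ↦ Finset.sum_comm, Finset.sum_comm]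
        exact Finset.sum_congr rfl fun k _ ↦ Finset.sum_comm
    _ = ∑ k, ∑ j, (P * Q) k j * (P * Q) j k := by
        simp only [Matrix.mul_apply, Finset.sum_mul_sum]
        refine Finset.sum_congr rfl fun k _ ↦ Finset.sum_congr rfl fun j _ ↦
          Finset.sum_congr rfl fun i _ ↦ Finset.sum_congr rfl fun l _ ↦ ?_
        rw [hP.apply k i, hQ.apply l k]
        ring
    _ = (P * Q * (P * Q)).trace := by
        simp only [Matrix.trace, Matrix.diag_apply, Matrix.mul_apply]

theorem tensorNormSq_eq_trace {V : Type*} [AddCommGroup V] [Module ℝ V] [FiniteDimensional ℝ V]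
    {B : LinearMap.BilinForm ℝ V} (hB : B.Nondegenerate) (hs : B.IsSymm) {b : V → V → ℝ}
    {R : End ℝ V} (hR : B.IsSelfAdjoint R) (hb : ∀ X Y, b X Y = B X (R Y)) :
    tensorNormSq B b = LinearMap.trace ℝ V (R * R) := by
  set e := Module.finBasis ℝ V
  let C := LinearMap.BilinForm.toMatrix e B
  let Q := LinearMap.BilinForm.toMatrix e (B.compRight R)
  have hC : (Matrix.of fun i j ↦ B (e i) (e j)) = C := by ext i j; simp [C]
  have hQ (i j) : b (e i) (e j) = Q i j := by simp [Q, hb]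
  have hCsymm : C⁻¹.IsSymm := by
    refine (Matrix.transpose_nonsing_inv C).trans (congrArg _ ?_)
    ext i j
    simp [C, hs.eq (e j)]
  have hQsymm : Q.IsSymm := by
    ext i j
    rw [Matrix.transpose_apply, ← hQ, ← hQ, hb, hb, ← hR, hs.eq]
  have hCQ : C⁻¹ * Q = LinearMap.toMatrix e e R := by
    have hdet : IsUnit C.det :=
      ((LinearMap.BilinForm.nondegenerate_iff_det_ne_zero e).1 hB).isUnit
    have hQC : Q = C * LinearMap.toMatrix e e R := LinearMap.BilinForm.toMatrix_compRight e B R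
    rw [hQC, Matrix.nonsing_inv_mul_cancel_left _ _ hdet]
  calc tensorNormSq B b
      = ∑ i, ∑ j, ∑ k, ∑ l, C⁻¹ i k * C⁻¹ j l * Q i j * Q k l := by
        simp only [← hQ, ← hC]
        rfl
    _ = (C⁻¹ * Q * (C⁻¹ * Q)).trace := sum_mul_mul_mul_eq_trace hCsymm hQsymm
    _ = LinearMap.trace ℝ V (R * R) := by
        rw [hCQ, ← LinearMap.toMatrix_mul, LinearMap.trace_eq_matrix_trace ℝ e]

variable {K : Type*} [Field K] {V : Type*} [AddCommGroup V] [Module K V]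
  {B : LinearMap.BilinForm K V}

theorem eq_of_forall_apply_eq (hB : B.Nondegenerate) {u v : V} (huv : ∀ w, B u w = B v w) :
    u = v :=
  LinearMap.ker_eq_bot.1 hB.ker_eq_bot (LinearMap.ext huv)

theorem isAdjointPair_symm (hs : B.IsSymm) {f g : End K V}
    (h : LinearMap.IsAdjointPair B B f g) : LinearMap.IsAdjointPair B B g f := fun u v ↦ by
  rw [hs.eq (g u), ← h, hs.eq]

theorem trace_eq_of_isAdjointPair [FiniteDimensional K V] (hB : B.Nondegenerate)
    {f g : End K V} (h : LinearMap.IsAdjointPair B B f g) :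
    LinearMap.trace K V f = LinearMap.trace K V g := by
  have hconj : (B.toDual hB).conj f = Module.Dual.transpose (R := K) g := by
    ext θ u
    obtain ⟨v, rfl⟩ := (B.toDual hB).surjective θ
    simpa [LinearEquiv.conj_apply_apply, Module.Dual.transpose_apply,
      LinearMap.BilinForm.toDual_def] using h v u
  rw [← LinearMap.trace_conj' f (B.toDual hB), hconj, LinearMap.trace_transpose']

/-- The operator `x ↦ ∑ k, B (w k) x • v k`; for `w = v` it is the frame operator of the family,
and for `w ≠ v` the mixed frame operator of the two families. -/
def frameOperator {ι : Type*} [Fintype ι] (B : LinearMap.BilinForm K V) (w v : ι → V) : End K V :=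
  ∑ k, (B (w k)).smulRight (v k)

section Frame

variable {ι : Type*} [Fintype ι]

theorem frameOperator_apply (w v : ι → V) (x : V) :
    frameOperator B w v x = ∑ k, B (w k) x • v k := by
  simp [frameOperator]

theorem mul_frameOperator (M : End K V) (w v : ι → V) :
    M * frameOperator B w v = frameOperator B w (M ∘ v) := by
  ext x; simp [frameOperator_apply]

theorem isAdjointPair_frameOperator (hs : B.IsSymm) (w v : ι → V) :
    LinearMap.IsAdjointPair B B (frameOperator B w v) (frameOperator B v w) := fun x y ↦ by
  simp only [frameOperator_apply, map_sum, map_smul, LinearMap.sum_apply, LinearMap.smul_apply,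
    smul_eq_mul]
  exact Finset.sum_congr rfl fun k _ ↦ by rw [hs.eq x, mul_comm]

theorem frameOperator_add_add (w v w' v' : ι → V) :
    frameOperator B (w + w') (v + v') = frameOperator B w v + frameOperator B w v' +
      frameOperator B w' v + frameOperator B w' v' := by
  ext x
  simp only [frameOperator_apply, LinearMap.add_apply, Pi.add_apply, map_add, smul_add, add_smul,
    Finset.sum_add_distrib]
  abel

theorem trace_mul_frameOperator [FiniteDimensional K V] (M : End K V) (w v : ι → V) :
    LinearMap.trace K V (M * frameOperator B w v) = ∑ k, B (w k) (M (v k)) := by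
  rw [mul_frameOperator, frameOperator, map_sum]
  simp only [LinearMap.trace_smulRight, Function.comp_apply]

theorem trace_mul_frameOperator_mul_frameOperator [FiniteDimensional K V] (M N : End K V)
    (w v : ι → V) :
    LinearMap.trace K V (M * frameOperator B w w * (N * frameOperator B v v)) =
      ∑ k, ∑ m, B (w m) (N (v k)) * B (v k) (M (w m)) := by
  rw [← mul_assoc, trace_mul_frameOperator]
  simp [frameOperator_apply]

/-- The family `Z` is a Parseval frame of the subspace `h` for the form `B`: its members lie in
`h`, and its frame operator is the identity on `h`. -/
structure IsParsevalFrame (B : LinearMap.BilinForm K V) (h : Submodule K V) (Z : ι → V) :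
    Prop where
  mem : ∀ k, Z k ∈ h
  frameOperator_apply_eq_self : ∀ u ∈ h, frameOperator B Z Z u = u

theorem isParsevalFrame_of_orthonormal [DecidableEq ι] {h : Submodule K V}
    (Z : Module.Basis ι K h) (hZ : ∀ p q, B (Z p) (Z q) = if p = q then 1 else 0) :
    IsParsevalFrame B h fun k ↦ (Z k : V) where
  mem k := (Z k).2
  frameOperator_apply_eq_self u hu := by
    have hid : frameOperator B (fun k ↦ (Z k : V)) (fun k ↦ (Z k : V)) ∘ₗ h.subtype = h.subtype :=
      Z.ext fun k ↦ by simp [frameOperator_apply, hZ]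
    exact LinearMap.congr_fun hid ⟨u, hu⟩

end Frame
end BilinearForms

section InvariantForms

open Module (End)
open LieAlgebra (ad)

variable {K : Type*} [Field K] {V : Type*} [LieRing V] [LieAlgebra K V]
  {B : LinearMap.BilinForm K V}

theorem isAdjointPair_ad (hi : B.lieInvariant V) (u : V) :
    LinearMap.IsAdjointPair B B (ad K V u) (-ad K V u : End K V) := fun v w ↦
  (hi u v w).trans (map_neg (B v) _).symm

theorem apply_lie_swap (hs : B.IsSymm) (hi : B.lieInvariant V) (u v w : V) :
    B ⁅u, v⁆ w = -B ⁅u, w⁆ v := by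
  rw [hi, hs.eq]

theorem apply_lie_cyclic (hs : B.IsSymm) (hi : B.lieInvariant V) (u v w : V) :
    B ⁅u, v⁆ w = B ⁅v, w⁆ u := by
  rw [← lie_skew u v, map_neg, LinearMap.neg_apply, apply_lie_swap hs hi, neg_neg]

theorem isAdjointPair_ad_mul_ad (hi : B.lieInvariant V) (u v : V) :
    LinearMap.IsAdjointPair B B (ad K V u * ad K V v) (ad K V v * ad K V u) := by
  have h := (isAdjointPair_ad hi u).mul (isAdjointPair_ad hi v)
  rwa [neg_mul_neg] at h

theorem apply_ad_ad (hs : B.IsSymm) (hi : B.lieInvariant V) (u v x y : V) :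
    B u (ad K V x (ad K V y v)) = B (ad K V v (ad K V u x)) y := by
  simp only [LieAlgebra.ad_apply]
  rw [hs.eq u, hi, hi v, ← lie_skew u x, ← lie_skew v y, map_neg B, LinearMap.neg_apply, map_neg,
    neg_neg, hs.eq]

theorem trace_ad_eq_zero [CharZero K] [FiniteDimensional K V] (hB : B.Nondegenerate)
    (hi : B.lieInvariant V) (u : V) : LinearMap.trace K V (ad K V u) = 0 := by
  have h := trace_eq_of_isAdjointPair hB (isAdjointPair_ad hi u)
  rwa [map_neg, self_eq_neg] at h

variable [FiniteDimensional K V]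

/-- The operator that represents the Killing form with respect to a nondegenerate form `B`. -/
noncomputable def killingOperator (hB : B.Nondegenerate) : End K V :=
  (B.toDual hB).symm.toLinearMap ∘ₗ killingForm K V

theorem apply_killingOperator (hB : B.Nondegenerate) (u v : V) :
    B (killingOperator hB u) v = killingForm K V u v := by
  simp [killingOperator, LinearMap.BilinForm.apply_toDual_symm_apply]

theorem isSelfAdjoint_killingOperator (hB : B.Nondegenerate) (hs : B.IsSymm) :
    B.IsSelfAdjoint (killingOperator hB) := fun u v ↦ by
  rw [apply_killingOperator, hs.eq u, apply_killingOperator,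
    LieModule.traceForm_comm]

theorem killingOperator_map (hB : B.Nondegenerate) {α : V ≃ₗ⁅K⁆ V}
    (hα : ∀ u v, B (α u) (α v) = B u v) (u : V) :
    killingOperator hB (α u) = α (killingOperator hB u) := by
  refine eq_of_forall_apply_eq hB fun w ↦ ?_
  obtain ⟨w, rfl⟩ : ∃ v, α v = w := α.surjective w
  rw [apply_killingOperator, hα, LieAlgebra.killingForm_of_equiv_apply, apply_killingOperator]

theorem conj_killingOperator (hB : B.Nondegenerate) {α : V ≃ₗ⁅K⁆ V}
    (hα : ∀ u v, B (α u) (α v) = B u v) :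
    (α : V ≃ₗ[K] V).conj (killingOperator hB) = killingOperator hB := by
  ext u
  exact (killingOperator_map hB hα (α.symm u)).symm.trans
    (congrArg (killingOperator hB) (α.apply_symm_apply u))

end InvariantForms

section Twist

open Module (End)
open LieAlgebra (ad)

variable {V : Type*} [LieRing V] [LieAlgebra ℝ V]

/-- A linear map `l` into an abelian subspace `h` of a metric Lie algebra `(V, B)`, with transpose
`j`, that vanishes on `h` and on `[h, V]`. -/
structure IsTwist (B : LinearMap.BilinForm ℝ V) (h : Submodule ℝ V) (l j : End ℝ V) : Prop where
  nondegenerate : B.Nondegenerate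
  isSymm : B.IsSymm
  lieInvariant : B.lieInvariant V
  lie_eq_zero : ∀ u ∈ h, ∀ v ∈ h, ⁅u, v⁆ = 0
  map_mem : ∀ u, l u ∈ h
  map_eq_zero : ∀ u ∈ h, l u = 0
  map_lie_left : ∀ u ∈ h, ∀ v, l ⁅u, v⁆ = 0
  isAdjointPair : LinearMap.IsAdjointPair B B j l

/-- The Levi-Civita connection `∇_X Y` of the scalar product `B` for the Lie bracket obtained from
`⁅·, ·⁆` by conjugation with `1 + l`, where `j` is the transpose of `l`. -/
noncomputable def twistConnection (l j : End ℝ V) : V →ₗ[ℝ] V →ₗ[ℝ] V :=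
  LinearMap.mk₂ ℝ (fun X Y ↦ (1 / 2 : ℝ) • (⁅X, Y⁆ - ⁅j X, Y⁆ + l ⁅X, Y⁆ + ⁅X, j Y⁆) - ⁅l X, Y⁆)
    (by intros; simp only [map_add, add_lie]; module)
    (by intros; simp only [map_smul, smul_lie]; module)
    (by intros; simp only [map_add, lie_add]; module)
    (by intros; simp only [map_smul, lie_smul]; module)

/-- The part of `X ↦ ∇_X W`, for `∇` the `twistConnection`, whose summands factor through `l` or
through `j`. -/
noncomputable def twistRemainder (l j : End ℝ V) (W : V) : End ℝ V :=
  (1 / 2 : ℝ) • (ad ℝ V W * j) - (1 / 2 : ℝ) • (l * ad ℝ V W) + ad ℝ V W * l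

theorem twistConnection_flip (l j : End ℝ V) (W : V) :
    (twistConnection l j).flip W = twistRemainder l j W - (1 / 2 : ℝ) • ad ℝ V (W + j W) := by
  ext X
  simp only [LinearMap.flip_apply, twistConnection, LinearMap.mk₂_apply, twistRemainder,
    LinearMap.add_apply, LinearMap.sub_apply, LinearMap.smul_apply, Module.End.mul_apply,
    LieAlgebra.ad_apply, add_lie]
  rw [← lie_skew X W, ← lie_skew (j X) W, ← lie_skew X (j W), ← lie_skew (l X) W, map_neg]
  module

section Operators

variable {ι : Type*} [Fintype ι]

/-- The sum of the squares of the `ad (j (Z k))`. -/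
noncomputable def squareSum (j : End ℝ V) (Z : ι → V) : End ℝ V :=
  ∑ k, ad ℝ V (j (Z k)) * ad ℝ V (j (Z k))

/-- The sum of the products of `ad (Z k)` and `ad (j (Z k))`. -/
noncomputable def mixedSum (j : End ℝ V) (Z : ι → V) : End ℝ V :=
  ∑ k, ad ℝ V (Z k) * ad ℝ V (j (Z k))

theorem trace_squareSum_sq (j : End ℝ V) (Z : ι → V) :
    LinearMap.trace ℝ V (squareSum j Z * squareSum j Z) =
      ∑ p, ∑ q, LinearMap.trace ℝ V (ad ℝ V (j (Z p)) ^ 2 * ad ℝ V (j (Z q)) ^ 2) := by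
  simp only [squareSum, Finset.sum_mul_sum, map_sum, pow_two]

theorem apply_squareSum (B : LinearMap.BilinForm ℝ V) (j : End ℝ V) (Z : ι → V) (u v : V) :
    B (squareSum j Z u) v = ∑ k, B (ad ℝ V (j (Z k)) (ad ℝ V (j (Z k)) u)) v := by
  simp [squareSum]

theorem isSelfAdjoint_squareSum {B : LinearMap.BilinForm ℝ V} (hi : B.lieInvariant V)
    (j : End ℝ V) (Z : ι → V) : B.IsSelfAdjoint (squareSum j Z) :=
  (B.mem_selfAdjointSubmodule _).1 <| sum_mem fun _ _ ↦
    (B.mem_selfAdjointSubmodule _).2 (isAdjointPair_ad_mul_ad hi _ _)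

end Operators

namespace IsTwist

variable {B : LinearMap.BilinForm ℝ V} {h : Submodule ℝ V} {l j : End ℝ V}

theorem isAdjointPair_flip (H : IsTwist B h l j) : LinearMap.IsAdjointPair B B l j :=
  isAdjointPair_symm H.isSymm H.isAdjointPair

theorem isAdjointPair_one_add (H : IsTwist B h l j) :
    LinearMap.IsAdjointPair B B (1 + j : End ℝ V) (1 + l : End ℝ V) :=
  LinearMap.isAdjointPair_one.add H.isAdjointPair

theorem map_lie_right (H : IsTwist B h l j) {u : V} (hu : u ∈ h) (v : V) : l ⁅v, u⁆ = 0 := by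
  rw [← lie_skew, map_neg, H.map_lie_left u hu, neg_zero]

theorem lie_transpose (H : IsTwist B h l j) {u : V} (hu : u ∈ h) (v : V) : ⁅u, j v⁆ = 0 :=
  eq_of_forall_apply_eq H.nondegenerate fun w ↦ by
    rw [H.lieInvariant, H.isAdjointPair, H.map_lie_left u hu]
    simp

theorem transpose_lie (H : IsTwist B h l j) {u : V} (hu : u ∈ h) (v : V) : ⁅j v, u⁆ = 0 := by
  rw [← lie_skew, H.lie_transpose hu, neg_zero]

theorem commute_ad (H : IsTwist B h l j) {u : V} (hu : u ∈ h) (v : V) :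
    Commute (ad ℝ V u) (ad ℝ V (j v)) := LinearMap.ext fun X ↦ by
  simp only [Module.End.mul_apply, LieAlgebra.ad_apply]
  rw [leibniz_lie, H.lie_transpose hu, zero_lie, zero_add]

theorem map_map (H : IsTwist B h l j) (u : V) : l (l u) = 0 := H.map_eq_zero _ (H.map_mem u)

theorem map_mul_map (H : IsTwist B h l j) : l * l = 0 := LinearMap.ext H.map_map

theorem one_add_mul_one_sub (H : IsTwist B h l j) : (1 + l) * (1 - l) = 1 := by
  rw [add_mul, mul_sub, mul_sub, H.map_mul_map]
  simp

theorem trace_one_sub_mul_mul_one_add (H : IsTwist B h l j) (M : End ℝ V) :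
    LinearMap.trace ℝ V ((1 - l) * M * (1 + l)) = LinearMap.trace ℝ V M := by
  rw [mul_assoc, LinearMap.trace_mul_comm, mul_assoc, H.one_add_mul_one_sub, mul_one]

theorem one_sub_mul_mul_one_add_mul (H : IsTwist B h l j) (M N : End ℝ V) :
    (1 - l) * M * (1 + l) * ((1 - l) * N * (1 + l)) = (1 - l) * (M * N) * (1 + l) := by
  calc (1 - l) * M * (1 + l) * ((1 - l) * N * (1 + l))
      = (1 - l) * M * ((1 + l) * (1 - l)) * N * (1 + l) := by simp only [mul_assoc]
    _ = (1 - l) * (M * N) * (1 + l) := by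
        simp only [H.one_add_mul_one_sub, mul_assoc, one_mul]

theorem one_add_lie (H : IsTwist B h l j) (u v : V) :
    ⁅u, v⁆ + l ⁅u, v⁆ = ⁅u + l u, v + l v⁆ + l ⁅u + l u, v + l v⁆
      - ⁅l (u + l u), v + l v⁆ - ⁅u + l u, l (v + l v)⁆ := by
  simp only [map_add, H.map_map, add_lie, lie_add, H.lie_eq_zero _ (H.map_mem u) _ (H.map_mem v),
    H.map_lie_left _ (H.map_mem u), H.map_lie_right (H.map_mem v), add_zero]
  abel

theorem koszul_twistConnection (H : IsTwist B h l j) (x y w : V) :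
    B (twistConnection l j x y) w =
      1 / 2 * (B (⁅x, y⁆ + l ⁅x, y⁆ - ⁅l x, y⁆ - ⁅x, l y⁆) w
        - B (⁅x, w⁆ + l ⁅x, w⁆ - ⁅l x, w⁆ - ⁅x, l w⁆) y
        - B (⁅y, w⁆ + l ⁅y, w⁆ - ⁅l y, w⁆ - ⁅y, l w⁆) x) := by
  simp only [twistConnection, LinearMap.mk₂_apply, map_add, map_sub, map_smul, LinearMap.add_apply,
    LinearMap.sub_apply, LinearMap.smul_apply, smul_eq_mul, H.isAdjointPair_flip _]
  have hswap := apply_lie_swap H.isSymm H.lieInvariant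
  have hcyclic := apply_lie_cyclic H.isSymm H.lieInvariant
  linarith [hswap x w y, hswap x w (j y), hswap (l x) w y, hswap x (l w) y, hcyclic x y w,
    hcyclic (j x) y w, hcyclic x (l y) w, hcyclic x y (l w)]

theorem isSymm_pullbackForm (H : IsTwist B h l j) : (pullbackForm B l).IsSymm :=
  ⟨fun _ _ ↦ H.isSymm.eq _ _⟩

theorem pullbackForm_one_sub (H : IsTwist B h l j) (u v : V) :
    pullbackForm B l ((1 - l) u) v = B u (v + l v) := by
  simp [pullbackForm, H.map_map]

theorem nondegenerate_pullbackForm (H : IsTwist B h l j) : (pullbackForm B l).Nondegenerate := by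
  refine H.isSymm_pullbackForm.isRefl.nondegenerate_iff_separatingLeft.mpr fun u hu ↦ ?_
  have hu' : u + l u = 0 := H.nondegenerate.1 _ fun w ↦ by
    rw [H.isSymm.eq, ← H.pullbackForm_one_sub, H.isSymm_pullbackForm.eq, hu]
  have hlu : l u = 0 := by simpa [H.map_map] using congrArg l hu'
  rwa [hlu, add_zero] at hu'

theorem koszul_pullbackForm (H : IsTwist B h l j) (X Y W : V) :
    pullbackForm B l (((twistConnection l j).compl₁₂ (1 + l) (1 + l)).compr₂ (1 - l) X Y) W =
      1 / 2 * (pullbackForm B l ⁅X, Y⁆ W - pullbackForm B l ⁅X, W⁆ Y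
        - pullbackForm B l ⁅Y, W⁆ X) := by
  have hpull (u v : V) : pullbackForm B l u v = B (u + l u) (v + l v) := rfl
  rw [LinearMap.compr₂_apply, H.pullbackForm_one_sub, hpull, hpull, hpull, H.one_add_lie X Y,
    H.one_add_lie X W, H.one_add_lie Y W]
  exact H.koszul_twistConnection _ _ _

theorem map_mul_ad_mul_map (H : IsTwist B h l j) (X : V) : l * ad ℝ V X * l = 0 := by
  ext u
  simp [H.map_lie_right (H.map_mem u)]

theorem transpose_mul_ad_mul_transpose (H : IsTwist B h l j) (X : V) : j * ad ℝ V X * j = 0 := by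
  ext u
  refine eq_of_forall_apply_eq H.nondegenerate fun w ↦ ?_
  simp only [Module.End.mul_apply, LieAlgebra.ad_apply, LinearMap.zero_apply, map_zero]
  rw [H.isAdjointPair, apply_lie_cyclic H.isSymm H.lieInvariant, H.transpose_lie (H.map_mem w)]
  simp

theorem transpose_mul_ad_mul_map (H : IsTwist B h l j) (X : V) : j * ad ℝ V X * l = 0 := by
  ext u
  refine eq_of_forall_apply_eq H.nondegenerate fun w ↦ ?_
  simp only [Module.End.mul_apply, LieAlgebra.ad_apply, LinearMap.zero_apply, map_zero]
  rw [H.isAdjointPair, apply_lie_cyclic H.isSymm H.lieInvariant,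
    H.lie_eq_zero _ (H.map_mem u) _ (H.map_mem w)]
  simp

section Frame

variable {ι : Type*} [Fintype ι] {Z : ι → V}

theorem mixedSum_eq_sum (H : IsTwist B h l j) (hZ : ∀ k, Z k ∈ h) :
    mixedSum j Z = ∑ k, ad ℝ V (j (Z k)) * ad ℝ V (Z k) :=
  Finset.sum_congr rfl fun k _ ↦ (H.commute_ad (hZ k) _).eq

theorem isSelfAdjoint_mixedSum (H : IsTwist B h l j) (hZ : ∀ k, Z k ∈ h) :
    B.IsSelfAdjoint (mixedSum j Z) := by
  refine (B.mem_selfAdjointSubmodule _).1 <| sum_mem fun k _ ↦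
    (B.mem_selfAdjointSubmodule _).2 ?_
  have h := isAdjointPair_ad_mul_ad H.lieInvariant (Z k) (j (Z k))
  rwa [← (H.commute_ad (hZ k) _).eq] at h

theorem squareSum_mul_map (H : IsTwist B h l j) : squareSum j Z * l = 0 := by
  ext u
  simp [squareSum, H.transpose_lie (H.map_mem u)]

theorem mixedSum_mul_map (H : IsTwist B h l j) : mixedSum j Z * l = 0 := by
  ext u
  simp [mixedSum, H.transpose_lie (H.map_mem u)]

theorem transpose_mul_eq_zero (H : IsTwist B h l j) {P : End ℝ V} (hP : B.IsSelfAdjoint P)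
    (hPl : P * l = 0) : j * P = 0 := by
  ext u
  refine eq_of_forall_apply_eq H.nondegenerate fun w ↦ ?_
  rw [Module.End.mul_apply, H.isAdjointPair, hP, ← Module.End.mul_apply, hPl]
  simp

theorem apply_mixedSum_add_transpose (H : IsTwist B h l j) (hZ : ∀ k, Z k ∈ h) (u v : V) :
    ∑ k, B (ad ℝ V (j (Z k)) (ad ℝ V (Z k) (u + j u))) v = B (mixedSum j Z u) v := by
  simp [H.mixedSum_eq_sum hZ, H.lie_transpose (hZ _)]

theorem eq_frameOperator (H : IsTwist B h l j) (F : IsParsevalFrame B h Z) :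
    l = frameOperator B (j ∘ Z) Z := by
  ext u
  conv_lhs => rw [← F.frameOperator_apply_eq_self _ (H.map_mem u)]
  simp only [frameOperator_apply, Function.comp_apply, H.isAdjointPair _ _]

theorem transpose_eq_frameOperator (H : IsTwist B h l j) (F : IsParsevalFrame B h Z) :
    j = frameOperator B Z (j ∘ Z) := by
  ext u
  refine eq_of_forall_apply_eq H.nondegenerate fun w ↦ ?_
  rw [H.isAdjointPair, isAdjointPair_frameOperator H.isSymm, ← H.eq_frameOperator F]

theorem one_add_transpose_mul_one_add (H : IsTwist B h l j) (F : IsParsevalFrame B h Z) :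
    (1 + j) * (1 + l) =
      1 + frameOperator B (Z + j ∘ Z) (Z + j ∘ Z) - frameOperator B Z Z := by
  have hjl : j * l = frameOperator B (j ∘ Z) (j ∘ Z) := by
    conv_lhs => rw [H.eq_frameOperator F, mul_frameOperator]
  rw [frameOperator_add_add, ← H.eq_frameOperator F, ← H.transpose_eq_frameOperator F, ← hjl]
  noncomm_ring

theorem trace_one_add_mul_mul_one_add_sq (H : IsTwist B h l j) (F : IsParsevalFrame B h Z)
    (M : End ℝ V) :
    LinearMap.trace ℝ V ((1 + l) * M * (1 + j) * ((1 + l) * M * (1 + j))) =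
      LinearMap.trace ℝ V (M * M)
        + 2 * LinearMap.trace ℝ V (M * M * frameOperator B (Z + j ∘ Z) (Z + j ∘ Z))
        - 2 * LinearMap.trace ℝ V (M * M * frameOperator B Z Z)
        + LinearMap.trace ℝ V (M * frameOperator B (Z + j ∘ Z) (Z + j ∘ Z)
          * (M * frameOperator B (Z + j ∘ Z) (Z + j ∘ Z)))
        - 2 * LinearMap.trace ℝ V (M * frameOperator B (Z + j ∘ Z) (Z + j ∘ Z)
          * (M * frameOperator B Z Z))
        + LinearMap.trace ℝ V (M * frameOperator B Z Z * (M * frameOperator B Z Z)) := by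
  have hcycle : LinearMap.trace ℝ V ((1 + l) * M * (1 + j) * ((1 + l) * M * (1 + j))) =
      LinearMap.trace ℝ V (M * ((1 + j) * (1 + l)) * (M * ((1 + j) * (1 + l)))) := by
    rw [mul_assoc (1 + l), mul_assoc (1 + l), LinearMap.trace_mul_comm]
    simp only [mul_assoc]
  rw [hcycle, H.one_add_transpose_mul_one_add F]
  generalize frameOperator B (Z + j ∘ Z) (Z + j ∘ Z) = P
  generalize frameOperator B Z Z = Q
  have hQP := LinearMap.trace_mul_comm ℝ (M * Q) (M * P)
  have hP := LinearMap.trace_mul_comm ℝ (M * P) M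
  have hQ := LinearMap.trace_mul_comm ℝ (M * Q) M
  simp only [mul_add, add_mul, mul_sub, sub_mul, mul_one, map_add, map_sub, hP, hQ, hQP,
    ← mul_assoc M M]
  ring

variable [FiniteDimensional ℝ V]

theorem trace_mul_map (H : IsTwist B h l j) (F : IsParsevalFrame B h Z) (M : End ℝ V) :
    LinearMap.trace ℝ V (M * l) = ∑ k, B (j (Z k)) (M (Z k)) := by
  conv_lhs => rw [H.eq_frameOperator F, trace_mul_frameOperator]
  rfl

theorem trace_mul_transpose (H : IsTwist B h l j) (F : IsParsevalFrame B h Z) (M : End ℝ V) :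
    LinearMap.trace ℝ V (M * j) = ∑ k, B (Z k) (M (j (Z k))) := by
  conv_lhs => rw [H.transpose_eq_frameOperator F, trace_mul_frameOperator]
  rfl

theorem trace_ad_mul_map (H : IsTwist B h l j) (F : IsParsevalFrame B h Z) (X : V) :
    LinearMap.trace ℝ V (ad ℝ V X * l) = 0 := by
  rw [H.trace_mul_map F]
  refine Finset.sum_eq_zero fun k _ ↦ ?_
  rw [LieAlgebra.ad_apply, H.isSymm.eq, apply_lie_cyclic H.isSymm H.lieInvariant,
    H.lie_transpose (F.mem k)]
  simp

theorem trace_ad_mul_transpose (H : IsTwist B h l j) (F : IsParsevalFrame B h Z) (X : V) :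
    LinearMap.trace ℝ V (ad ℝ V X * j) = 0 := by
  rw [H.trace_mul_transpose F]
  refine Finset.sum_eq_zero fun k _ ↦ ?_
  rw [LieAlgebra.ad_apply, H.isSymm.eq, apply_lie_cyclic H.isSymm H.lieInvariant,
    H.transpose_lie (F.mem k)]
  simp

theorem trace_twistConnection_flip (H : IsTwist B h l j) (F : IsParsevalFrame B h Z) (W : V) :
    LinearMap.trace ℝ V ((twistConnection l j).flip W) = 0 := by
  rw [twistConnection_flip, twistRemainder]
  simp only [map_add, map_sub, map_smul, trace_ad_eq_zero H.nondegenerate H.lieInvariant,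
    LinearMap.trace_mul_comm ℝ l, H.trace_ad_mul_map F, H.trace_ad_mul_transpose F]
  simp

theorem trace_ad_mul_twistRemainder (H : IsTwist B h l j) (F : IsParsevalFrame B h Z) (W Y : V) :
    LinearMap.trace ℝ V (ad ℝ V (W + j W) * twistRemainder l j Y) = B (mixedSum j Z W) Y := by
  have had := apply_ad_ad H.isSymm H.lieInvariant
  have hYj : LinearMap.trace ℝ V (ad ℝ V (W + j W) * (ad ℝ V Y * j)) = B (mixedSum j Z W) Y := by
    rw [← mul_assoc, H.trace_mul_transpose F, ← H.apply_mixedSum_add_transpose F.mem]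
    exact Finset.sum_congr rfl fun k _ ↦ had _ _ _ _
  have hlY : LinearMap.trace ℝ V (ad ℝ V (W + j W) * (l * ad ℝ V Y)) = B (mixedSum j Z W) Y := by
    rw [← mul_assoc, LinearMap.trace_mul_comm, ← mul_assoc, H.trace_mul_map F,
      ← H.apply_mixedSum_add_transpose F.mem]
    refine Finset.sum_congr rfl fun k _ ↦ ?_
    rw [Module.End.mul_apply, had, H.isSymm.eq]
    exact (isAdjointPair_ad_mul_ad H.lieInvariant (j (Z k)) (Z k) _ _).symm
  have hYl : LinearMap.trace ℝ V (ad ℝ V (W + j W) * (ad ℝ V Y * l)) = B (mixedSum j Z W) Y := by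
    rw [← mul_assoc, H.trace_mul_map F, ← H.apply_mixedSum_add_transpose F.mem]
    refine Finset.sum_congr rfl fun k _ ↦ ?_
    rw [Module.End.mul_apply, had]
    exact congrArg (B · Y) (LinearMap.congr_fun (H.commute_ad (F.mem k) (Z k)).eq _)
  rw [twistRemainder]
  generalize ad ℝ V (W + j W) = a at *
  simp only [mul_add, mul_sub, mul_smul_comm, map_add, map_sub, map_smul, smul_eq_mul, hYj, hlY,
    hYl]
  ring

theorem trace_twistRemainder_mul (H : IsTwist B h l j) (F : IsParsevalFrame B h Z) (W Y : V) :
    LinearMap.trace ℝ V (twistRemainder l j W * twistRemainder l j Y) =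
      -(1 / 2) * B (squareSum j Z W) Y := by
  have had := apply_ad_ad H.isSymm H.lieInvariant
  have hjl : LinearMap.trace ℝ V (ad ℝ V W * j * (l * ad ℝ V Y)) = B (squareSum j Z W) Y := by
    rw [← mul_assoc, LinearMap.trace_mul_comm, ← mul_assoc, ← mul_assoc, H.trace_mul_map F,
      isSelfAdjoint_squareSum H.lieInvariant, H.isSymm.eq, apply_squareSum]
    exact Finset.sum_congr rfl fun k _ ↦ had _ _ _ _
  have hlj : LinearMap.trace ℝ V (l * ad ℝ V W * (ad ℝ V Y * j)) = B (squareSum j Z W) Y := by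
    rw [mul_assoc, LinearMap.trace_mul_comm, ← mul_assoc, H.trace_mul_map F, apply_squareSum]
    exact Finset.sum_congr rfl fun k _ ↦ had _ _ _ _
  have hjj : ad ℝ V W * j * (ad ℝ V Y * j) = 0 := by
    rw [mul_assoc, ← mul_assoc j, H.transpose_mul_ad_mul_transpose, mul_zero]
  have hjl' : ad ℝ V W * j * (ad ℝ V Y * l) = 0 := by
    rw [mul_assoc, ← mul_assoc j, H.transpose_mul_ad_mul_map, mul_zero]
  have hll : l * ad ℝ V W * (l * ad ℝ V Y) = 0 := by
    rw [← mul_assoc, H.map_mul_ad_mul_map, zero_mul]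
  have hll' : LinearMap.trace ℝ V (l * ad ℝ V W * (ad ℝ V Y * l)) = 0 := by
    rw [LinearMap.trace_mul_comm, mul_assoc, ← mul_assoc l, H.map_mul_map, zero_mul, mul_zero,
      map_zero]
  have hlj' : LinearMap.trace ℝ V (ad ℝ V W * l * (ad ℝ V Y * j)) = 0 := by
    rw [LinearMap.trace_mul_comm, mul_assoc, ← mul_assoc j, H.transpose_mul_ad_mul_map, mul_zero,
      map_zero]
  have hll₂ : ad ℝ V W * l * (l * ad ℝ V Y) = 0 := by
    rw [mul_assoc, ← mul_assoc l, H.map_mul_map, zero_mul, mul_zero]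
  have hll₃ : ad ℝ V W * l * (ad ℝ V Y * l) = 0 := by
    rw [mul_assoc, ← mul_assoc l, H.map_mul_ad_mul_map, mul_zero]
  simp only [twistRemainder, add_mul, mul_add, sub_mul, mul_sub, smul_mul_assoc, mul_smul_comm,
    map_add, map_sub, map_smul, map_zero, smul_eq_mul, hjl, hlj, hjj, hjl', hll, hll', hlj', hll₂,
    hll₃]
  ring

end Frame
end IsTwist

end Twist

section RicciOperator

open Module (End)
open LieAlgebra (ad)

theorem trace_mul_one_add_mul_mul_one_add {R V : Type*} [CommRing R] [AddCommGroup V]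
    [Module R V] {P l j : End R V} (hl : P * l = 0) (hj : j * P = 0) (M : End R V) :
    LinearMap.trace R V (P * ((1 + l) * M * (1 + j))) = LinearMap.trace R V (P * M) := by
  have hPl : P * ((1 + l) * M * (1 + j)) = P * M * (1 + j) := by
    calc P * ((1 + l) * M * (1 + j)) = (P + P * l) * M * (1 + j) := by noncomm_ring
      _ = P * M * (1 + j) := by rw [hl, add_zero]
  rw [hPl, LinearMap.trace_mul_comm, add_mul, ← mul_assoc j, hj, zero_mul, add_zero, one_mul]

variable {V : Type*} [LieRing V] [LieAlgebra ℝ V] [FiniteDimensional ℝ V]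
  {B : LinearMap.BilinForm ℝ V} {h : Submodule ℝ V} {l j : End ℝ V} {ι : Type*} [Fintype ι]
  {Z : ι → V}

/-- The Ricci operator of the scalar product `B` for the Lie bracket obtained from `⁅·, ·⁆` by
conjugation with `1 + l`, where `j` is the transpose of `l` and `Z` is a Parseval frame of a
subspace that contains the image of `l`. -/
noncomputable def ricciOperator (hB : B.Nondegenerate) (l j : End ℝ V) (Z : ι → V) : End ℝ V :=
  (1 / 2 : ℝ) • squareSum j Z + mixedSum j Z
    - (1 / 4 : ℝ) • ((1 + l) * killingOperator hB * (1 + j))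

namespace IsTwist

theorem neg_trace_twistConnection_flip_mul (H : IsTwist B h l j) (F : IsParsevalFrame B h Z)
    (v w : V) :
    -LinearMap.trace ℝ V ((twistConnection l j).flip w * (twistConnection l j).flip v) =
      B (ricciOperator H.nondegenerate l j Z w) v := by
  have hK : B (((1 + l) * killingOperator H.nondegenerate * (1 + j)) w) v =
      LinearMap.trace ℝ V (ad ℝ V (w + j w) * ad ℝ V (v + j v)) := by
    rw [mul_assoc, Module.End.mul_apply, isAdjointPair_symm H.isSymm H.isAdjointPair_one_add,
      Module.End.mul_apply, apply_killingOperator, killingForm_apply_apply]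
    rfl
  have hvw := H.trace_ad_mul_twistRemainder F v w
  rw [H.isSelfAdjoint_mixedSum F.mem, H.isSymm.eq, LinearMap.trace_mul_comm] at hvw
  have hwv := H.trace_ad_mul_twistRemainder F w v
  have hr := H.trace_twistRemainder_mul F w v
  rw [twistConnection_flip, twistConnection_flip]
  simp only [ricciOperator, LinearMap.add_apply, LinearMap.sub_apply, LinearMap.smul_apply, hK,
    map_add B, map_sub B, map_smul B]
  generalize ad ℝ V (w + j w) = a at *
  generalize ad ℝ V (v + j v) = b at *
  simp only [sub_mul, mul_sub, smul_mul_assoc, mul_smul_comm, map_sub, map_smul, smul_eq_mul, hvw,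
    hwv, hr]
  ring

theorem isSelfAdjoint_ricciOperator (H : IsTwist B h l j) (hZ : ∀ k, Z k ∈ h) :
    B.IsSelfAdjoint (ricciOperator H.nondegenerate l j Z) := by
  have hK := ((isAdjointPair_symm H.isSymm H.isAdjointPair_one_add).mul
    (isSelfAdjoint_killingOperator H.nondegenerate H.isSymm)).mul H.isAdjointPair_one_add
  rw [← mul_assoc] at hK
  exact (((isSelfAdjoint_squareSum H.lieInvariant j Z).smul _).add
    (H.isSelfAdjoint_mixedSum hZ)).sub (hK.smul _)

theorem trace_ricciOperator_sq (H : IsTwist B h l j) (hZ : ∀ k, Z k ∈ h) :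
    LinearMap.trace ℝ V
        (ricciOperator H.nondegenerate l j Z * ricciOperator H.nondegenerate l j Z) =
      1 / 4 * LinearMap.trace ℝ V (squareSum j Z * squareSum j Z)
        + (LinearMap.trace ℝ V (mixedSum j Z * mixedSum j Z)
          + LinearMap.trace ℝ V (squareSum j Z * mixedSum j Z)
          - 1 / 4 * LinearMap.trace ℝ V (squareSum j Z * killingOperator H.nondegenerate)
          - 1 / 2 * LinearMap.trace ℝ V (mixedSum j Z * killingOperator H.nondegenerate)
          + 1 / 16 * LinearMap.trace ℝ V
            ((1 + l) * killingOperator H.nondegenerate * (1 + j)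
              * ((1 + l) * killingOperator H.nondegenerate * (1 + j)))) := by
  have hSl : squareSum j Z * l = 0 := H.squareSum_mul_map
  have hNl : mixedSum j Z * l = 0 := H.mixedSum_mul_map
  have hS := trace_mul_one_add_mul_mul_one_add hSl
    (H.transpose_mul_eq_zero (isSelfAdjoint_squareSum H.lieInvariant j Z) hSl)
    (killingOperator H.nondegenerate)
  have hN := trace_mul_one_add_mul_mul_one_add hNl
    (H.transpose_mul_eq_zero (H.isSelfAdjoint_mixedSum hZ) hNl) (killingOperator H.nondegenerate)
  unfold ricciOperator
  generalize (1 + l) * killingOperator H.nondegenerate * (1 + j) = L at *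
  simp only [add_mul, mul_add, sub_mul, mul_sub, smul_mul_assoc, mul_smul_comm, map_add, map_sub,
    map_smul, smul_eq_mul, hS, hN, LinearMap.trace_mul_comm ℝ (mixedSum j Z) (squareSum j Z),
    LinearMap.trace_mul_comm ℝ L (squareSum j Z), LinearMap.trace_mul_comm ℝ L (mixedSum j Z)]
  ring

end IsTwist
end RicciOperator

section Curvature

variable {E : Type*} [NormedAddCommGroup E] [NormedSpace ℝ E] [FiniteDimensional ℝ E]
  {G : Type*} [TopologicalSpace G] [ChartedSpace E G] [Group G] [LieGroup 𝓘(ℝ, E) ∞ G]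
  {B : LinearMap.BilinForm ℝ (GroupLieAlgebra 𝓘(ℝ, E) G)}
  {h : Submodule ℝ (GroupLieAlgebra 𝓘(ℝ, E) G)}
  {l j : Module.End ℝ (GroupLieAlgebra 𝓘(ℝ, E) G)} {ι : Type*} [Fintype ι]
  {Z : ι → GroupLieAlgebra 𝓘(ℝ, E) G}

local notation "𝔤" => GroupLieAlgebra 𝓘(ℝ, E) G

theorem ricci_leftInvariantMetric_pullbackForm (H : IsTwist B h l j) (F : IsParsevalFrame B h Z)
    (v w : 𝔤) :
    ricci (leftInvariantMetric (pullbackForm B l)) v w =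
      pullbackForm B l v (((1 - l) * ricciOperator H.nondegenerate l j Z * (1 + l)) w) := by
  set D := ((twistConnection l j).compl₁₂ (1 + l) (1 + l)).compr₂ (1 - l)
  have hflip (u : 𝔤) : D.flip u = (1 - l) * (twistConnection l j).flip (u + l u) * (1 + l) := rfl
  rw [ricci_leftInvariantMetric H.nondegenerate_pullbackForm H.isSymm_pullbackForm D
    H.koszul_pullbackForm]
  · rw [hflip, hflip, H.one_sub_mul_mul_one_add_mul, H.trace_one_sub_mul_mul_one_add,
      H.neg_trace_twistConnection_flip_mul F, H.isSymm_pullbackForm.eq]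
    exact (H.pullbackForm_one_sub _ _).symm
  · intro W
    rw [hflip, H.trace_one_sub_mul_mul_one_add, H.trace_twistConnection_flip F]

theorem tensorNormSq_ricci_leftInvariantMetric (H : IsTwist B h l j) (F : IsParsevalFrame B h Z) :
    tensorNormSq (pullbackForm B l) (ricci (leftInvariantMetric (pullbackForm B l))) =
      LinearMap.trace ℝ 𝔤
        (ricciOperator H.nondegenerate l j Z * ricciOperator H.nondegenerate l j Z) := by
  have hself : (pullbackForm B l).IsSelfAdjoint
      ((1 - l) * ricciOperator H.nondegenerate l j Z * (1 + l)) := fun u v ↦ by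
    rw [H.isSymm_pullbackForm.eq u, mul_assoc, Module.End.mul_apply (1 - l),
      Module.End.mul_apply (1 - l), H.pullbackForm_one_sub, H.pullbackForm_one_sub,
      Module.End.mul_apply, H.isSelfAdjoint_ricciOperator F.mem,
      H.isSymm.eq]
    rfl
  rw [tensorNormSq_eq_trace H.nondegenerate_pullbackForm H.isSymm_pullbackForm hself
    (ricci_leftInvariantMetric_pullbackForm H F), H.one_sub_mul_mul_one_add_mul,
    H.trace_one_sub_mul_mul_one_add]

end Curvature

section Polarization

open Module (End)

variable {K M V : Type*} [Field K] [AddCommGroup M] [Module K M] [AddCommGroup V]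
  [Module K V] {W : End K V} {A A' : M →ₗ[K] End K V}

theorem six_mul_trace_mul_mul_mul {a b : End K V} (ha : Commute W a) :
    6 * LinearMap.trace K V (W * (a * a * b)) =
      LinearMap.trace K V (W * ((b + a) * (b + a) * (b + a)))
        + LinearMap.trace K V (W * ((b - a) * (b - a) * (b - a)))
        - 2 * LinearMap.trace K V (W * (b * b * b)) := by
  have haba : LinearMap.trace K V (W * (a * b * a)) = LinearMap.trace K V (W * (a * a * b)) := by
    rw [← mul_assoc, LinearMap.trace_mul_comm, ← mul_assoc, ← ha.eq]
    simp only [mul_assoc]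
  have hbaa : LinearMap.trace K V (W * (b * a * a)) = LinearMap.trace K V (W * (a * a * b)) := by
    rw [← haba, ← mul_assoc, LinearMap.trace_mul_comm, ← mul_assoc, ← ha.eq]
    simp only [mul_assoc]
  simp only [add_mul, mul_add, sub_mul, mul_sub, map_add, map_sub, haba, hbaa]
  ring

variable [CharZero K]

theorem trace_mul_mul_eq_of_trace_mul_sq_eq (hA : ∀ u, Commute W (A u))
    (hA' : ∀ u, Commute W (A' u))
    (h : ∀ u, LinearMap.trace K V (W * (A u * A u)) = LinearMap.trace K V (W * (A' u * A' u)))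
    (u v : M) :
    LinearMap.trace K V (W * (A u * A v)) = LinearMap.trace K V (W * (A' u * A' v)) := by
  let form (C : M →ₗ[K] End K V) : LinearMap.BilinForm K M :=
    ((LinearMap.mul K (End K V)).compl₁₂ C C).compr₂ (LinearMap.trace K V ∘ₗ LinearMap.mulLeft K W)
  have hform {C : M →ₗ[K] End K V} (hC : ∀ u, Commute W (C u)) : (form C).IsSymm := ⟨fun u v ↦ by
    change LinearMap.trace K V (W * (C u * C v)) = LinearMap.trace K V (W * (C v * C u))
    rw [← mul_assoc, LinearMap.trace_mul_comm, ← mul_assoc, ← (hC v).eq, mul_assoc]⟩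
  exact LinearMap.congr_fun₂
    (LinearMap.BilinForm.ext_of_isSymm (hform hA) (hform hA') h : form A = form A') u v

theorem trace_mul_mul_mul_eq_of_trace_mul_cube_eq (hA : ∀ u, Commute W (A u))
    (hA' : ∀ u, Commute W (A' u))
    (h : ∀ u, LinearMap.trace K V (W * (A u * A u * A u)) =
      LinearMap.trace K V (W * (A' u * A' u * A' u))) (u v : M) :
    LinearMap.trace K V (W * (A u * A u * A v)) =
      LinearMap.trace K V (W * (A' u * A' u * A' v)) := by
  refine mul_left_cancel₀ (b := LinearMap.trace K V _) (by norm_num : (6 : K) ≠ 0) ?_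
  rw [six_mul_trace_mul_mul_mul (hA u), six_mul_trace_mul_mul_mul (hA' u)]
  simp only [← map_add A, ← map_sub A, ← map_add A', ← map_sub A', h]

end Polarization

section Aligned

open Module (End)
open LieAlgebra (ad)

variable {V : Type*} [LieRing V] [LieAlgebra ℝ V] {B : LinearMap.BilinForm ℝ V}
  {h : Submodule ℝ V} {l l' j j' : End ℝ V}

/-- For every `z ∈ h` there is an isometric automorphism of the metric Lie algebra `(V, B)` that
fixes `h` pointwise and maps `j' z` to `j z`. The automorphism depends on `z`. -/
def IsAligned (B : LinearMap.BilinForm ℝ V) (h : Submodule ℝ V) (j j' : End ℝ V) : Prop :=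
  ∀ z ∈ h, ∃ α : V ≃ₗ⁅ℝ⁆ V, (∀ u v, B (α u) (α v) = B u v) ∧ (∀ w ∈ h, α w = w) ∧ α (j' z) = j z

namespace IsAligned

theorem trace_ad_mul_ad_mul_sq_eq (A : IsAligned B h j j') {u v z : V} (hu : u ∈ h) (hv : v ∈ h)
    (hz : z ∈ h) :
    LinearMap.trace ℝ V (ad ℝ V u * ad ℝ V v * (ad ℝ V (j z) * ad ℝ V (j z))) =
      LinearMap.trace ℝ V (ad ℝ V u * ad ℝ V v * (ad ℝ V (j' z) * ad ℝ V (j' z))) := by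
  obtain ⟨α, -, hfix, hαz⟩ := A z hz
  rw [← LinearMap.trace_conj' (_ * (ad ℝ V (j' z) * ad ℝ V (j' z))) (α : V ≃ₗ[ℝ] V)]
  simp only [Module.End.mul_eq_comp, LinearEquiv.conj_comp, LieAlgebra.conj_ad_apply, hαz,
    hfix u hu, hfix v hv]

theorem trace_ad_mul_cube_eq (A : IsAligned B h j j') {u z : V} (hu : u ∈ h) (hz : z ∈ h) :
    LinearMap.trace ℝ V (ad ℝ V u * (ad ℝ V (j z) * ad ℝ V (j z) * ad ℝ V (j z))) =
      LinearMap.trace ℝ V (ad ℝ V u * (ad ℝ V (j' z) * ad ℝ V (j' z) * ad ℝ V (j' z))) := by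
  obtain ⟨α, -, hfix, hαz⟩ := A z hz
  rw [← LinearMap.trace_conj' (_ * (_ * _ * ad ℝ V (j' z))) (α : V ≃ₗ[ℝ] V)]
  simp only [Module.End.mul_eq_comp, LinearEquiv.conj_comp, LieAlgebra.conj_ad_apply, hαz,
    hfix u hu]

theorem killingForm_add_eq_left (A : IsAligned B h j j') {u z : V} (hu : u ∈ h) (hz : z ∈ h) :
    killingForm ℝ V u (z + j z) = killingForm ℝ V u (z + j' z) := by
  obtain ⟨α, -, hfix, hαz⟩ := A z hz
  rw [← LieAlgebra.killingForm_of_equiv_apply α u (z + j' z), map_add α, hαz, hfix z hz, hfix u hu]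

theorem killingForm_add_add_eq (A : IsAligned B h j j') {u v : V} (hu : u ∈ h) (hv : v ∈ h) :
    killingForm ℝ V (u + j u) (v + j v) = killingForm ℝ V (u + j' u) (v + j' v) := by
  let form (f : End ℝ V) : LinearMap.BilinForm ℝ h :=
    (killingForm ℝ V).compl₁₂ ((1 + f) ∘ₗ h.subtype) ((1 + f) ∘ₗ h.subtype)
  have hsymm (f : End ℝ V) : (form f).IsSymm := ⟨fun _ _ ↦ LieModule.traceForm_comm ..⟩
  have hdiag (z : h) : form j z z = form j' z z := by
    obtain ⟨α, -, hfix, hαz⟩ := A z z.2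
    change killingForm ℝ V (z + j z) (z + j z) = killingForm ℝ V (z + j' z) (z + j' z)
    rw [← LieAlgebra.killingForm_of_equiv_apply α (z + j' z), map_add α, hαz, hfix z z.2]
  exact LinearMap.congr_fun₂ (LinearMap.BilinForm.ext_of_isSymm (hsymm j) (hsymm j') hdiag)
    ⟨u, hu⟩ ⟨v, hv⟩

section Frame

variable {ι : Type*} [Fintype ι] {Z : ι → V}

theorem trace_mixedSum_sq_eq (A : IsAligned B h j j') (H : IsTwist B h l j)
    (H' : IsTwist B h l' j') (hZ : ∀ k, Z k ∈ h) :
    LinearMap.trace ℝ V (mixedSum j Z * mixedSum j Z) =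
      LinearMap.trace ℝ V (mixedSum j' Z * mixedSum j' Z) := by
  simp only [mixedSum, Finset.sum_mul_sum, map_sum]
  refine Finset.sum_congr rfl fun k _ ↦ Finset.sum_congr rfl fun m _ ↦ ?_
  have hcomm {l j : End ℝ V} (H : IsTwist B h l j) (u : h) :
      Commute (ad ℝ V (Z k) * ad ℝ V (Z m)) (ad ℝ V (j u)) :=
    (H.commute_ad (hZ k) u).mul_left (H.commute_ad (hZ m) u)
  rw [(H.commute_ad (hZ m) _).symm.mul_mul_mul_comm, (H'.commute_ad (hZ m) _).symm.mul_mul_mul_comm]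
  exact trace_mul_mul_eq_of_trace_mul_sq_eq
    (A := (ad ℝ V : V →ₗ[ℝ] End ℝ V) ∘ₗ j ∘ₗ h.subtype)
    (A' := (ad ℝ V : V →ₗ[ℝ] End ℝ V) ∘ₗ j' ∘ₗ h.subtype) (hcomm H) (hcomm H')
    (fun u ↦ A.trace_ad_mul_ad_mul_sq_eq (hZ k) (hZ m) u.2) ⟨Z k, hZ k⟩ ⟨Z m, hZ m⟩

theorem trace_squareSum_mul_mixedSum_eq (A : IsAligned B h j j') (H : IsTwist B h l j)
    (H' : IsTwist B h l' j') (hZ : ∀ k, Z k ∈ h) :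
    LinearMap.trace ℝ V (squareSum j Z * mixedSum j Z) =
      LinearMap.trace ℝ V (squareSum j' Z * mixedSum j' Z) := by
  simp only [mixedSum, squareSum, Finset.sum_mul_sum, map_sum]
  refine Finset.sum_congr rfl fun k _ ↦ Finset.sum_congr rfl fun m _ ↦ ?_
  have hcomm {l j : End ℝ V} (H : IsTwist B h l j) (u : V) := (H.commute_ad (hZ m) u).symm
  rw [((hcomm H _).mul_left (hcomm H _)).left_comm, ((hcomm H' _).mul_left (hcomm H' _)).left_comm]
  exact trace_mul_mul_mul_eq_of_trace_mul_cube_eq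
    (A := (ad ℝ V : V →ₗ[ℝ] End ℝ V) ∘ₗ j ∘ₗ h.subtype)
    (A' := (ad ℝ V : V →ₗ[ℝ] End ℝ V) ∘ₗ j' ∘ₗ h.subtype) (fun u ↦ H.commute_ad (hZ m) u)
    (fun u ↦ H'.commute_ad (hZ m) u) (fun u ↦ A.trace_ad_mul_cube_eq (hZ m) u.2)
    ⟨Z k, hZ k⟩ ⟨Z m, hZ m⟩

variable [FiniteDimensional ℝ V]

theorem trace_squareSum_mul_killingOperator_eq (A : IsAligned B h j j') (hB : B.Nondegenerate)
    (hZ : ∀ k, Z k ∈ h) :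
    LinearMap.trace ℝ V (squareSum j Z * killingOperator hB) =
      LinearMap.trace ℝ V (squareSum j' Z * killingOperator hB) := by
  simp only [squareSum, Finset.sum_mul, map_sum]
  refine Finset.sum_congr rfl fun k _ ↦ ?_
  obtain ⟨α, hα, -, hαz⟩ := A _ (hZ k)
  rw [← LinearMap.trace_conj' (ad ℝ V (j' (Z k)) * _ * _) (α : V ≃ₗ[ℝ] V)]
  simp only [Module.End.mul_eq_comp, LinearEquiv.conj_comp, LieAlgebra.conj_ad_apply, hαz,
    conj_killingOperator hB hα]

theorem trace_mixedSum_mul_killingOperator_eq (A : IsAligned B h j j') (hB : B.Nondegenerate)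
    (hZ : ∀ k, Z k ∈ h) :
    LinearMap.trace ℝ V (mixedSum j Z * killingOperator hB) =
      LinearMap.trace ℝ V (mixedSum j' Z * killingOperator hB) := by
  simp only [mixedSum, Finset.sum_mul, map_sum]
  refine Finset.sum_congr rfl fun k _ ↦ ?_
  obtain ⟨α, hα, hfix, hαz⟩ := A _ (hZ k)
  rw [← LinearMap.trace_conj' (_ * ad ℝ V (j' (Z k)) * _) (α : V ≃ₗ[ℝ] V)]
  simp only [Module.End.mul_eq_comp, LinearEquiv.conj_comp, LieAlgebra.conj_ad_apply, hαz,
    conj_killingOperator hB hα, hfix _ (hZ k)]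

end Frame

variable [FiniteDimensional ℝ V]

theorem apply_killingOperator_sq_eq (A : IsAligned B h j j') (hB : B.Nondegenerate) {z : V}
    (hz : z ∈ h) :
    B (z + j z) ((killingOperator hB * killingOperator hB) (z + j z)) =
      B (z + j' z) ((killingOperator hB * killingOperator hB) (z + j' z)) := by
  obtain ⟨α, hα, hfix, hαz⟩ := A z hz
  have hmap : z + j z = α (z + j' z) := by rw [map_add, hαz, hfix z hz]
  rw [hmap, Module.End.mul_apply, Module.End.mul_apply, killingOperator_map hB hα,
    killingOperator_map hB hα, hα]

variable {ι : Type*} [Fintype ι] {Z : ι → V}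

theorem trace_killingOperator_sq_mul_frameOperator_eq (A : IsAligned B h j j')
    (hB : B.Nondegenerate) (hZ : ∀ k, Z k ∈ h) :
    LinearMap.trace ℝ V (killingOperator hB * killingOperator hB
        * frameOperator B (Z + j ∘ Z) (Z + j ∘ Z)) =
      LinearMap.trace ℝ V (killingOperator hB * killingOperator hB
        * frameOperator B (Z + j' ∘ Z) (Z + j' ∘ Z)) := by
  rw [trace_mul_frameOperator, trace_mul_frameOperator]
  exact Finset.sum_congr rfl fun k _ ↦ A.apply_killingOperator_sq_eq hB (hZ k)

theorem trace_killing_add_add_eq (A : IsAligned B h j j') (hB : B.Nondegenerate) (hs : B.IsSymm)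
    (hZ : ∀ k, Z k ∈ h) :
    LinearMap.trace ℝ V (killingOperator hB * frameOperator B (Z + j ∘ Z) (Z + j ∘ Z)
        * (killingOperator hB * frameOperator B (Z + j ∘ Z) (Z + j ∘ Z))) =
      LinearMap.trace ℝ V (killingOperator hB * frameOperator B (Z + j' ∘ Z) (Z + j' ∘ Z)
        * (killingOperator hB * frameOperator B (Z + j' ∘ Z) (Z + j' ∘ Z))) := by
  simp only [trace_mul_frameOperator_mul_frameOperator, ← isSelfAdjoint_killingOperator hB hs _ _,
    apply_killingOperator, Pi.add_apply, Function.comp_apply,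
    A.killingForm_add_add_eq (hZ _) (hZ _)]

theorem trace_killing_add_eq (A : IsAligned B h j j') (hB : B.Nondegenerate) (hs : B.IsSymm)
    (hZ : ∀ k, Z k ∈ h) :
    LinearMap.trace ℝ V (killingOperator hB * frameOperator B (Z + j ∘ Z) (Z + j ∘ Z)
        * (killingOperator hB * frameOperator B Z Z)) =
      LinearMap.trace ℝ V (killingOperator hB * frameOperator B (Z + j' ∘ Z) (Z + j' ∘ Z)
        * (killingOperator hB * frameOperator B Z Z)) := by
  simp only [trace_mul_frameOperator_mul_frameOperator, ← isSelfAdjoint_killingOperator hB hs _ _,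
    apply_killingOperator, Pi.add_apply, Function.comp_apply,
    LieModule.traceForm_comm ℝ V V (_ + _), A.killingForm_add_eq_left (hZ _) (hZ _)]

theorem trace_ricciOperator_sq_sub (A : IsAligned B h j j') (H : IsTwist B h l j)
    (H' : IsTwist B h l' j') (F : IsParsevalFrame B h Z) :
    LinearMap.trace ℝ V (ricciOperator H.nondegenerate l j Z * ricciOperator H.nondegenerate l j Z)
      - LinearMap.trace ℝ V
        (ricciOperator H'.nondegenerate l' j' Z * ricciOperator H'.nondegenerate l' j' Z) =
    1 / 4 * (LinearMap.trace ℝ V (squareSum j Z * squareSum j Z)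
      - LinearMap.trace ℝ V (squareSum j' Z * squareSum j' Z)) := by
  have hB := H.nondegenerate
  rw [H.trace_ricciOperator_sq F.mem, H'.trace_ricciOperator_sq F.mem,
    A.trace_mixedSum_sq_eq H H' F.mem, A.trace_squareSum_mul_mixedSum_eq H H' F.mem,
    A.trace_squareSum_mul_killingOperator_eq hB F.mem,
    A.trace_mixedSum_mul_killingOperator_eq hB F.mem, H.trace_one_add_mul_mul_one_add_sq F,
    H'.trace_one_add_mul_mul_one_add_sq F, A.trace_killingOperator_sq_mul_frameOperator_eq hB F.mem,
    A.trace_killing_add_add_eq hB H.isSymm F.mem, A.trace_killing_add_eq hB H.isSymm F.mem]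
  ring

end IsAligned
end Aligned

section AdInvariantForm

variable {E : Type*} [NormedAddCommGroup E] [NormedSpace ℝ E] [FiniteDimensional ℝ E]
  {G : Type*} [TopologicalSpace G] [ChartedSpace E G] [Group G] [LieGroup 𝓘(ℝ, E) ∞ G]

local notation "𝔤" => GroupLieAlgebra 𝓘(ℝ, E) G

theorem IsAdmissible.isTwist {B : LinearMap.BilinForm ℝ 𝔤} {𝔥 : Submodule ℝ 𝔤}
    {l j : 𝔤 →ₗ[ℝ] 𝔤} (hl : IsAdmissible B 𝔥 l) (hB : B.Nondegenerate) (hs : B.IsSymm)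
    (hi : B.lieInvariant 𝔤) (h𝔥 : ∀ u ∈ 𝔥, ∀ v ∈ 𝔥, ⁅u, v⁆ = 0)
    (hj : LinearMap.IsAdjointPair B B j l) : IsTwist B 𝔥 l j where
  nondegenerate := hB
  isSymm := hs
  lieInvariant := hi
  lie_eq_zero := h𝔥
  map_mem := hl.map_mem
  map_eq_zero u hu := hl.map_eq_zero u (Submodule.mem_sup_left hu)
  map_lie_left u hu v := by
    refine hl.map_eq_zero _ (Submodule.mem_sup_right fun w hw ↦ ?_)
    have hwu : ⁅w, u⁆ = 0 := hw u hu
    have h := hi u w v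
    rw [← lie_skew, hwu, neg_zero, map_zero, LinearMap.zero_apply] at h
    exact neg_eq_zero.1 h.symm
  isAdjointPair := hj

theorem isAligned_of_Ad {B : LinearMap.BilinForm ℝ 𝔤} {𝔥 : Submodule ℝ 𝔤}
    {l l' j j' : 𝔤 →ₗ[ℝ] 𝔤} (hB : B.Nondegenerate) (hs : B.IsSymm)
    (hAd : ∀ (a : G) u v, B (Ad a u) (Ad a v) = B u v)
    (hj : LinearMap.IsAdjointPair B B j l) (hj' : LinearMap.IsAdjointPair B B j' l')
    (h3 : ∀ Z ∈ 𝔥, ∃ a : G, (∀ X, B (l' X) Z = B (l (Ad a X)) Z) ∧ ∀ W ∈ 𝔥, Ad a W = W) :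
    IsAligned B 𝔥 j j' := by
  intro z hz
  obtain ⟨a, ha, hfix⟩ := h3 z hz
  have Ad_Ad_inv (v : 𝔤) : Ad a (Ad a⁻¹ v) = v := by simpa using Ad_inv_Ad a⁻¹ v
  refine ⟨{ Ad a with
    map_lie' := fun {v w} ↦ Ad_lie a v w
    invFun := Ad a⁻¹
    left_inv := Ad_inv_Ad a
    right_inv := Ad_Ad_inv }, hAd a, hfix, ?_⟩
  refine eq_of_forall_apply_eq hB fun y ↦ ?_
  change B (Ad a (j' z)) y = B (j z) y
  calc B (Ad a (j' z)) y = B (Ad a (j' z)) (Ad a (Ad a⁻¹ y)) := by rw [Ad_Ad_inv]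
    _ = B (l' (Ad a⁻¹ y)) z := by rw [hAd, hj', hs.eq]
    _ = B (j z) y := by rw [ha, Ad_Ad_inv, hs.eq, hj]

end AdInvariantForm
end LeftInvariantRicci

theorem theorem3p14_general
    {E : Type*} [NormedAddCommGroup E] [NormedSpace ℝ E] [FiniteDimensional ℝ E]
    {G : Type*} [TopologicalSpace G] [ChartedSpace E G] [Group G] [LieGroup 𝓘(ℝ, E) ∞ G]
    {B : LinearMap.BilinForm ℝ (GroupLieAlgebra 𝓘(ℝ, E) G)} (hB : B.Nondegenerate) (hs : B.IsSymm)
    (hAd : ∀ (a : G) u v, B (Ad a u) (Ad a v) = B u v)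
    {𝔥 : Submodule ℝ (GroupLieAlgebra 𝓘(ℝ, E) G)} (h𝔥 : ∀ u ∈ 𝔥, ∀ v ∈ 𝔥, ⁅u, v⁆ = 0)
    {l l' j j' : GroupLieAlgebra 𝓘(ℝ, E) G →ₗ[ℝ] GroupLieAlgebra 𝓘(ℝ, E) G}
    (hl : IsAdmissible B 𝔥 l) (hl' : IsAdmissible B 𝔥 l')
    (hj : LinearMap.IsAdjointPair B B j l) (hj' : LinearMap.IsAdjointPair B B j' l')
    (h3 : ∀ Z ∈ 𝔥, ∃ a : G, (∀ X, B (l' X) Z = B (l (Ad a X)) Z) ∧ ∀ W ∈ 𝔥, Ad a W = W)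
    {ι : Type*} [Fintype ι] [DecidableEq ι] (Z : Module.Basis ι ℝ 𝔥)
    (hZ : ∀ p q, B (Z p) (Z q) = if p = q then 1 else 0) :
    tensorNormSq (pullbackForm B l) (ricci (leftInvariantMetric (pullbackForm B l)))
      - tensorNormSq (pullbackForm B l') (ricci (leftInvariantMetric (pullbackForm B l')))
    = 1 / 4 *
      ((∑ p, ∑ q, LinearMap.trace ℝ (GroupLieAlgebra 𝓘(ℝ, E) G)
          (LieAlgebra.ad ℝ _ (j (Z p)) ^ 2 * LieAlgebra.ad ℝ _ (j (Z q)) ^ 2))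
      - ∑ p, ∑ q, LinearMap.trace ℝ (GroupLieAlgebra 𝓘(ℝ, E) G)
          (LieAlgebra.ad ℝ _ (j' (Z p)) ^ 2 * LieAlgebra.ad ℝ _ (j' (Z q)) ^ 2)) := by
  have hi := lieInvariant_of_Ad_Ad hAd
  have T := hl.isTwist hB hs hi h𝔥 hj
  have T' := hl'.isTwist hB hs hi h𝔥 hj'
  have F := isParsevalFrame_of_orthonormal Z hZ
  rw [tensorNormSq_ricci_leftInvariantMetric T F, tensorNormSq_ricci_leftInvariantMetric T' F,
    (isAligned_of_Ad hB hs hAd hj hj' h3).trace_ricciOperator_sq_sub T T' F,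
    trace_squareSum_sq, trace_squareSum_sq]

theorem theorem3p14
    {E : Type*} [NormedAddCommGroup E] [NormedSpace ℝ E] [FiniteDimensional ℝ E]
    {F : Type*} [NormedAddCommGroup F] [NormedSpace ℝ F] [FiniteDimensional ℝ F]
    -- a compact Lie group `G` with a bi-invariant metric `g₀`
    {G : Type*} [TopologicalSpace G] [T2Space G] [CompactSpace G] [ChartedSpace E G] [Group G]
    [LieGroup 𝓘(ℝ, E) ∞ G]
    (g₀ : ContMDiffRiemannianMetric 𝓘(ℝ, E) ∞ E (fun x : G ↦ TangentSpace 𝓘(ℝ, E) x))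
    (hg₀ : IsBiInvariant g₀)
    -- a torus in `G`: the image of a compact connected abelian Lie group under an injective
    -- smooth homomorphism, and its Lie algebra `𝔥`
    {H : Type*} [TopologicalSpace H] [T2Space H] [CompactSpace H] [ConnectedSpace H]
    [ChartedSpace F H] [CommGroup H] [LieGroup 𝓘(ℝ, F) ∞ H]
    (i : H →* G) (hi : ContMDiff 𝓘(ℝ, F) 𝓘(ℝ, E) ∞ i) (hinj : Function.Injective i)
    (𝔥 : Submodule ℝ (GroupLieAlgebra 𝓘(ℝ, E) G)) (h𝔥 : 𝔥 = LinearMap.range (differential (F := F) i))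
    -- the linear maps `l`, `l'` and condition (*3)
    (l l' : GroupLieAlgebra 𝓘(ℝ, E) G →ₗ[ℝ] GroupLieAlgebra 𝓘(ℝ, E) G)
    (hl : IsAdmissible (scalarProduct g₀) 𝔥 l) (hl' : IsAdmissible (scalarProduct g₀) 𝔥 l')
    (h3 : ∀ Z ∈ 𝔥, ∃ a : G,
      (∀ X : GroupLieAlgebra 𝓘(ℝ, E) G,
        scalarProduct g₀ (l' X) Z = scalarProduct g₀ (l (Ad a X)) Z) ∧
      ∀ W ∈ 𝔥, Ad a W = W)
    -- an orthonormal basis of `𝔥`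
    {r : ℕ} (Z : Module.Basis (Fin r) ℝ 𝔥)
    (hZ : ∀ p q, scalarProduct g₀ (Z p) (Z q) = if p = q then 1 else 0) :
    tensorNormSq (pullbackForm (scalarProduct g₀) l)
        (ricci (leftInvariantMetric (pullbackForm (scalarProduct g₀) l)))
      - tensorNormSq (pullbackForm (scalarProduct g₀) l')
        (ricci (leftInvariantMetric (pullbackForm (scalarProduct g₀) l')))
    = (1 / 4) *
      ((∑ p, ∑ q, LinearMap.trace ℝ (GroupLieAlgebra 𝓘(ℝ, E) G)
          (LieAlgebra.ad ℝ (GroupLieAlgebra 𝓘(ℝ, E) G) (transpose g₀ l (Z p)) ^ 2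
            * LieAlgebra.ad ℝ (GroupLieAlgebra 𝓘(ℝ, E) G) (transpose g₀ l (Z q)) ^ 2))
      - ∑ p, ∑ q, LinearMap.trace ℝ (GroupLieAlgebra 𝓘(ℝ, E) G)
          (LieAlgebra.ad ℝ (GroupLieAlgebra 𝓘(ℝ, E) G) (transpose g₀ l' (Z p)) ^ 2
            * LieAlgebra.ad ℝ (GroupLieAlgebra 𝓘(ℝ, E) G) (transpose g₀ l' (Z q)) ^ 2)) := by
  have h𝔥_abelian : ∀ u ∈ 𝔥, ∀ v ∈ 𝔥, ⁅u, v⁆ = 0 := by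
    subst h𝔥
    rintro _ ⟨u, rfl⟩ _ ⟨v, rfl⟩
    exact lie_differential_eq_zero i (hi.mdifferentiableAt (by simp)) u v
  have transpose_adjoint (φ : GroupLieAlgebra 𝓘(ℝ, E) G →ₗ[ℝ] GroupLieAlgebra 𝓘(ℝ, E) G) :
      LinearMap.IsAdjointPair (scalarProduct g₀) (scalarProduct g₀) (transpose g₀ φ) φ :=
    LinearMap.BilinForm.isAdjointPairLeftAdjointOfNondegenerate _ _ φ
  exact theorem3p14_general (scalarProduct_nondegenerate g₀) ⟨fun v w ↦ g₀.symm 1 v w⟩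
    (scalarProduct_Ad_Ad hg₀) h𝔥_abelian hl hl' (transpose_adjoint l) (transpose_adjoint l') h3 Z hZ
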